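/- Let $(R,\mathfrak m)$ be a Cohen--Macaulay (Noetherian) local ring of dimension $d>0$, $I$ an $\mathfrak m$-primary ideal, and $J=(a_1,\dots,a_d)\subseteq I$ a minimal reduction of $I$ generated by $d$ elements (every minimal reduction is of this form when $R/\mathfrak m$ is infinite). Let $\mathcal R(I)=\bigoplus_{n\ge0}I^nt^n$ and let $$gr_{Jt}(\mathcal R(I))=\bigoplus_{j\ge0}\frac{(Jt\,\mathcal R(I))^j}{(Jt\,\mathcal R(I))^{j+1}}\,U^j,\qquad C=\frac{\mathcal R(I)}{Jt\,\mathcal R(I)}[T_1,\dots,T_d],$$ where $t$ has bidegree $(1,0)$, $U$ has bidegree $(0,1)$ and each $T_i$ has bidegree $(1,1)$, so that the pieces of bidegree $(i+j,j)$ are $\frac{I^iJ^j}{I^{i-1}J^{j+1}}t^{i+j}U^j$ and $\frac{I^i}{JI^{i-1}}t^i[T_1,\dots,T_d]_j$ respectively. Let $\pi:C\to gr_{Jt}(\mathcal R(I))$ be the surjection of bigraded rings that is the identity on $\mathcal R(I)/Jt\,\mathcal R(I)$ and sends $T_i$ to $a_itU$. For a bigraded module $M$ and $p\ge0$ let $M_{[p]}=\bigoplus_{m-n=p+1}M_{(m,n)}$.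 Put $\Sigma^{I,J}_{[p]}=gr_{Jt}(\mathcal R(I))_{[p]}$, $K^{I,J}_{[p]}=(\ker\pi)_{[p]}$ and $K^{I,J}=\bigoplus_{p\ge0}K^{I,J}_{[p]}$. The Hilbert functions of $\Sigma^{I,J}_{[p]}$ and $K^{I,J}_{[p]}$ are $n\mapsto length_R$ of the piece of bidegree $(n+p+1,n)$; that of $K^{I,J}$ is $h(m,n)=\sum_{0\le j\le n}length_R(K^{I,J}_{(m,j)})$, which for $m\ge m_0$, $n\ge m+n_0$ (with some constants $m_0,n_0$) is a polynomial in $m$ alone. These Hilbert polynomials exist and have degree at most $d-1$; $e_0$ denotes $(d-1)!$ times the coefficient of degree $d-1$ (so $e_0=0$ if the degree is smaller). The integers $e_j(I)$ are defined by $length_R(R/I^{n+1})=\sum_{j=0}^{d}(-1)^je_j(I)\binom{n+d-j}{d-j}$ for $n\gg0$. For $p\ge0$ put $$\Delta_p(I,J)=length_R\Big(\frac{I^{p+1}\cap J}{JI^p}\Big),\quad \Lambda_p(I,J)=length_R\Big(\frac{I^{p+1}}{JI^p}\Big),\quad \delta_p(I,J)=e_0(K^{I,J}_{[p]}),$$ and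 put $\Delta(I,J)=\sum_{p\ge1}\Delta_p(I,J)$, $\Lambda(I,J)=\sum_{p\ge0}\Lambda_p(I,J)$ and $\delta(I,J)=\Lambda(I,J)-e_1(I)$. Then all these lengths are finite, all but finitely many of the numbers $\Delta_p(I,J)$, $\Lambda_p(I,J)$, $\delta_p(I,J)$, $e_0(\Sigma^{I,J}_{[p]})$ vanish, and the following hold. (i) For every $p\ge0$, $$\Delta_p(I,J)\ \ge\ \delta_p(I,J)=\Lambda_p(I,J)-e_0(\Sigma^{I,J}_{[p]})\ \ge\ 0\qquad\text{and}\qquad e_0(\Sigma^{I,J}_{[p]})\ge0.$$ (ii) $\delta(I,J)=e_0(K^{I,J})=\sum_{p\ge0}\delta_p(I,J)$ and $$\Delta(I,J)\ \ge\ \delta(I,J)=\Lambda(I,J)-e_1(I)\ \ge\ 0.$$ (iii) $$e_1(I)=\sum_{p\ge0}e_0(\Sigma^{I,J}_{[p]})=\sum_{p\ge0}\big(\Lambda_p(I,J)-\delta_p(I,J)\big).$$ -/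

import Mathlib

open Polynomial Filter

noncomputable section

namespace BigradedSally

/-! ### Cohen-Macaulay local rings and minimal reductions -/

/-- A (Noetherian) local ring is Cohen-Macaulay if its maximal ideal contains a regular
sequence whose length is the Krull dimension, i.e. if its depth equals its dimension. -/
def IsCohenMacaulayLocal (R : Type*) [CommRing R] [IsLocalRing R] : Prop :=
  ∃ rs : List R, (∀ x ∈ rs, x ∈ IsLocalRing.maximalIdeal R) ∧
    RingTheory.Sequence.IsRegular R rs ∧ ((rs.length : ℕ) : WithBot ℕ∞) = ringKrullDim R

/-- `J` is a reduction of `I`. -/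
def IsReduction {R : Type*} [CommRing R] (J I : Ideal R) : Prop :=
  J ≤ I ∧ ∃ r : ℕ, I ^ (r + 1) = J * I ^ r

/-- `J` is a minimal reduction of `I`: no ideal properly contained in `J` is a reduction
of `I`. -/
def IsMinimalReduction {R : Type*} [CommRing R] (J I : Ideal R) : Prop :=
  IsReduction J I ∧ ∀ L : Ideal R, L ≤ J → IsReduction L I → L = J

/-! ### Hilbert coefficients -/

/-- The function `h` agrees, for large arguments, with the polynomial
`∑_{j < d} (-1)^j e_j binom(n + d - 1 - j, d - 1 - j)`, of degree at most `d - 1`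
(in particular `h n` is then finite). -/
def IsHilbertCoeffs (d : ℕ) (h : ℕ → ℕ∞) (e : ℕ → ℤ) : Prop :=
  ∀ᶠ n in atTop, ∃ k : ℕ, h n = (k : ℕ∞) ∧
    (k : ℤ) = ∑ j ∈ Finset.range d,
      (-1 : ℤ) ^ j * e j * ((n + (d - 1 - j)).choose (d - 1 - j) : ℤ)

open Classical in
/-- The `j`-th Hilbert coefficient of `h`, for `j < d`, with respect to the degree `d - 1`.
It is uniquely determined when it exists. For `j = 0` it is the multiplicity: `(d - 1)!` times
the coefficient of degree `d - 1` of the Hilbert polynomial (hence `0` if the Hilbert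
polynomial has smaller degree). -/
def hilbertCoeff (d : ℕ) (h : ℕ → ℕ∞) (j : ℕ) : ℤ :=
  if H : ∃ e : ℕ → ℤ, IsHilbertCoeffs d h e then H.choose j else 0

/-- The function `h m n` agrees, for all `m ≥ m₀` and `n ≥ m + n₀`, with the polynomial
`∑_{j < d} (-1)^j e_j binom(m + d - 1 - j, d - 1 - j)` in `m` alone. -/
def IsBigradedHilbertCoeffs (d : ℕ) (h : ℕ → ℕ → ℕ∞) (e : ℕ → ℤ) : Prop :=
  ∃ m₀ n₀ : ℕ, ∀ m ≥ m₀, ∀ n ≥ m + n₀, ∃ k : ℕ, h m n = (k : ℕ∞) ∧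
    (k : ℤ) = ∑ j ∈ Finset.range d,
      (-1 : ℤ) ^ j * e j * ((m + (d - 1 - j)).choose (d - 1 - j) : ℤ)

open Classical in
/-- The `j`-th Hilbert coefficient of a bigraded Hilbert function depending on `m` only. -/
def bigradedHilbertCoeff (d : ℕ) (h : ℕ → ℕ → ℕ∞) (j : ℕ) : ℤ :=
  if H : ∃ e : ℕ → ℤ, IsBigradedHilbertCoeffs d h e then H.choose j else 0

section

variable {R : Type*} [CommRing R]

/-- The length of the `R`-module `L / N`, for ideals `N ⊆ L`. -/
def quotLength (L N : Ideal R) : ℕ∞ :=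
  Module.length R (↥L ⧸ Submodule.comap L.subtype N)

/-- The Hilbert functions `h^i_I`: `h^0_I(n)` is the length of `I^n / I^(n+1)`, and
`h^{i+1}_I(n) = ∑_{j ≤ n} h^i_I(j)`. -/
def hilbertFn (I : Ideal R) : ℕ → ℕ → ℕ∞
  | 0, n => quotLength (I ^ n) (I ^ (n + 1))
  | i + 1, n => ∑ j ∈ Finset.range (n + 1), hilbertFn I i j

/-- The Hilbert coefficient `e_j(I)` for `0 ≤ j ≤ d`, `d` the dimension of the ring: it is
read off from `h^1_I(n) = ∑_{j ≤ d} (-1)^j e_j(I) binom(n + d - j, d - j)`, `n` large. -/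
def idealHilbertCoeff (d : ℕ) (I : Ideal R) (j : ℕ) : ℤ :=
  hilbertCoeff (d + 1) (hilbertFn I 1) j

/-! ### The numbers `Λ` and `Δ` -/

/-- `Λ_p(I,J)`, the length of `I^(p+1) / J I^p`. -/
def LambdaLoc (I J : Ideal R) (p : ℕ) : ℤ :=
  ((quotLength (I ^ (p + 1)) (J * I ^ p)).toNat : ℤ)

/-- `Δ_p(I,J)`, the length of `(I^(p+1) ∩ J) / J I^p`. -/
def DeltaLoc (I J : Ideal R) (p : ℕ) : ℤ :=
  ((quotLength (I ^ (p + 1) ⊓ J) (J * I ^ p)).toNat : ℤ)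

/-- `Λ(I,J) = ∑_{p ≥ 0} Λ_p(I,J)`. -/
def LambdaTot (I J : Ideal R) : ℤ := ∑ᶠ p : ℕ, LambdaLoc I J p

/-- `Δ(I,J) = ∑_{p ≥ 1} Δ_p(I,J)`. -/
def DeltaTot (I J : Ideal R) : ℤ := ∑ᶠ (p : ℕ) (_ : 1 ≤ p), DeltaLoc I J p

/-- `δ(I,J) = Λ(I,J) - e_1(I)`. -/
def deltaTot (d : ℕ) (I J : Ideal R) : ℤ := LambdaTot I J - idealHilbertCoeff d I 1

/-! ### Associated graded rings -/

/-- The associated graded ring `⨁_n Q^n / Q^(n+1)` of a commutative ring with respect to an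
ideal `Q`, as the quotient of the Rees algebra `⨁_n Q^n U^n` of `Q` by the ideal generated
by `Q`, namely `⨁_n Q^(n+1) U^n`. -/
def AssocGr {A : Type*} [CommRing A] (Q : Ideal A) : Type _ :=
  ↥(reesAlgebra Q) ⧸ Q.map (algebraMap A ↥(reesAlgebra Q))

instance {A : Type*} [CommRing A] (Q : Ideal A) : CommRing (AssocGr Q) :=
  inferInstanceAs (CommRing (↥(reesAlgebra Q) ⧸ Q.map (algebraMap A ↥(reesAlgebra Q))))

instance {A : Type*} [CommRing A] [Algebra R A] (Q : Ideal A) : Algebra R (AssocGr Q) :=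
  inferInstanceAs (Algebra R (↥(reesAlgebra Q) ⧸ Q.map (algebraMap A ↥(reesAlgebra Q))))

/-- The quotient map from the Rees algebra `⨁_n Q^n U^n` to the associated graded ring. -/
def AssocGr.mk {A : Type*} [CommRing A] [Algebra R A] (Q : Ideal A) :
    ↥(reesAlgebra Q) →ₐ[R] AssocGr Q :=
  Ideal.Quotient.mkₐ R (Q.map (algebraMap A ↥(reesAlgebra Q)))

/-- The class in the associated graded ring of the element `f U^n`, for `f ∈ Q^n`. -/
def AssocGr.of {A : Type*} [CommRing A] (Q : Ideal A) (n : ℕ) (f : A) (hf : f ∈ Q ^ n) :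
    AssocGr Q :=
  AssocGr.mk (R := A) Q ⟨monomial n f, reesAlgebra.monomial_mem.mpr hf⟩

/-- The structure map `A / Q → gr_Q(A)`, onto the piece of degree zero. -/
def AssocGr.base {A : Type*} [CommRing A] (Q : Ideal A) : A ⧸ Q →+* AssocGr Q :=
  Ideal.quotientMap _ (algebraMap A ↥(reesAlgebra Q)) Ideal.le_comap_map

/-- The element `c t^n` of the Rees algebra of `I`, for `c ∈ I^n`. -/
def reesMonomial (I : Ideal R) (n : ℕ) (c : R) (hc : c ∈ I ^ n) : ↥(reesAlgebra I) :=
  ⟨monomial n c, reesAlgebra.monomial_mem.mpr hc⟩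

/-- The homogeneous ideal `Jt R(I)` of the Rees algebra `R(I)` of `I`. -/
def reesIdeal (I J : Ideal R) : Ideal ↥(reesAlgebra I) :=
  Ideal.span {f | ∃ b ∈ J, (f : R[X]) = monomial 1 b}

/-- The piece of degree `n` of the Rees algebra of `I`, namely `I^n t^n`. -/
def reesPiece (I : Ideal R) (n : ℕ) : Submodule R ↥(reesAlgebra I) :=
  Submodule.comap (reesAlgebra I).val.toLinearMap
    (LinearMap.range (monomial n : R →ₗ[R] R[X]))

/-- The ring `gr_{Jt}(R(I))`. -/
abbrev GrRees (I J : Ideal R) : Type _ := AssocGr (reesIdeal I J)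

/-- The piece of bidegree `(i + j, j)` of `gr_{Jt}(R(I))`: the classes of the elements `f U^j`
with `f ∈ (Jt R(I))^j` homogeneous of degree `i + j` in `t`. -/
def grPiece (I J : Ideal R) (i j : ℕ) : Submodule R (GrRees I J) where
  carrier := {z | ∃ (f : ↥(reesAlgebra I)) (hf : f ∈ reesIdeal I J ^ j),
    f ∈ reesPiece I (i + j) ∧ AssocGr.of (reesIdeal I J) j f hf = z}
  add_mem' := by
    rintro _ _ ⟨f, hf, hf', rfl⟩ ⟨g, hg, hg', rfl⟩
    refine ⟨f + g, Ideal.add_mem _ hf hg, Submodule.add_mem _ hf' hg', ?_⟩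
    unfold AssocGr.of
    rw [← map_add]
    congr 1
    exact Subtype.ext (map_add _ _ _)
  zero_mem' := by
    refine ⟨0, Ideal.zero_mem _, Submodule.zero_mem _, ?_⟩
    unfold AssocGr.of
    rw [← map_zero (AssocGr.mk (R := ↥(reesAlgebra I)) (reesIdeal I J))]
    congr 1
    exact Subtype.ext (map_zero _)
  smul_mem' := by
    rintro c _ ⟨f, hf, hf', rfl⟩
    refine ⟨c • f, Submodule.smul_of_tower_mem _ c hf, Submodule.smul_mem _ c hf', ?_⟩
    unfold AssocGr.of
    change AssocGr.mk (R := R) (reesIdeal I J) _ = c • AssocGr.mk (R := R) (reesIdeal I J) _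
    rw [← map_smul]
    congr 1
    exact Subtype.ext (smul_monomial c j f).symm

/-! ### The bigraded ring `C = (R(I) / Jt R(I))[T_1, …, T_d]` and the ideal `K` -/

/-- The ring `R(I) / Jt R(I) = ⨁_n I^n / J I^(n-1) t^n`. -/
def FiberRing (I J : Ideal R) : Type _ := ↥(reesAlgebra I) ⧸ reesIdeal I J

instance (I J : Ideal R) : CommRing (FiberRing I J) :=
  inferInstanceAs (CommRing (↥(reesAlgebra I) ⧸ reesIdeal I J))

instance (I J : Ideal R) : Algebra R (FiberRing I J) :=
  inferInstanceAs (Algebra R (↥(reesAlgebra I) ⧸ reesIdeal I J))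

/-- The quotient map `R(I) → R(I) / Jt R(I)`. -/
def FiberRing.mk (I J : Ideal R) : ↥(reesAlgebra I) →ₐ[R] FiberRing I J :=
  Ideal.Quotient.mkₐ R (reesIdeal I J)

/-- The map `R(I) / Jt R(I) → gr_{Jt}(R(I))` onto the piece of degree zero in `U`. -/
def FiberRing.toGr (I J : Ideal R) : FiberRing I J →+* GrRees I J :=
  AssocGr.base (reesIdeal I J)

/-- The bigraded ring `C^{I,J} = (R(I) / Jt R(I))[T_1, …, T_d]`. -/
abbrev CRing (I J : Ideal R) (d : ℕ) : Type _ :=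
  MvPolynomial (Fin d) (FiberRing I J)

/-- The piece of degree `n` of `R(I) / Jt R(I)`, namely the image of `I^n t^n`. -/
def fiberPiece (I J : Ideal R) (n : ℕ) : Submodule R (FiberRing I J) :=
  (reesPiece I n).map (FiberRing.mk I J).toLinearMap

/-- The piece of bidegree `(i + j, j)` of `C^{I,J}`: the homogeneous polynomials of degree `j`
in `T_1, …, T_d` with coefficients in the piece of degree `i` of `R(I) / Jt R(I)`. -/
def cPiece (I J : Ideal R) (d i j : ℕ) : Submodule R (CRing I J d) where
  carrier := {F | F.IsHomogeneous j ∧ ∀ s, F.coeff s ∈ fiberPiece I J i}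
  add_mem' := by
    rintro F G ⟨hF, hF'⟩ ⟨hG, hG'⟩
    exact ⟨hF.add hG, fun s => by
      rw [MvPolynomial.coeff_add]; exact Submodule.add_mem _ (hF' s) (hG' s)⟩
  zero_mem' := ⟨MvPolynomial.isHomogeneous_zero _ _ _, fun s => by simp⟩
  smul_mem' := by
    rintro c F ⟨hF, hF'⟩
    refine ⟨fun s hs => hF fun h0 => hs ?_, fun s => ?_⟩
    · rw [MvPolynomial.coeff_smul, h0, smul_zero]
    · rw [MvPolynomial.coeff_smul]; exact Submodule.smul_mem _ c (hF' s)

/-- The morphism `π : C^{I,J} → gr_{Jt}(R(I))`, `T_i ↦ a_i t U`, where `a_1, …, a_d ∈ J`. -/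
def piHom {I J : Ideal R} (hJI : J ≤ I) {d : ℕ} (a : Fin d → ↥J) :
    CRing I J d →+* GrRees I J :=
  MvPolynomial.eval₂Hom (FiberRing.toGr I J) fun i =>
    AssocGr.of (reesIdeal I J) 1
      (reesMonomial I 1 (a i : R) (by rw [pow_one]; exact hJI (a i).2))
      (by rw [pow_one]; exact Ideal.subset_span ⟨(a i : R), (a i).2, rfl⟩)

/-- The piece of bidegree `(i + j, j)` of the kernel of `π`. -/
def kerPiece {I J : Ideal R} (hJI : J ≤ I) {d : ℕ} (a : Fin d → ↥J) (i j : ℕ) :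
    Submodule R (CRing I J d) :=
  (RingHom.ker (piHom hJI a)).restrictScalars R ⊓ cPiece I J d i j

/-! ### The diagonal modules `Σ_[p]`, `K_[p]` and their multiplicities -/

/-- The Hilbert function of `Σ^{I,J}_[p]`, `p ≥ 0`: the length of the piece of bidegree
`(p + 1 + n, n)` of `gr_{Jt}(R(I))`. -/
def sigmaHilb (I J : Ideal R) (p n : ℕ) : ℕ∞ :=
  Module.length R ↥(grPiece I J (p + 1) n)

/-- The Hilbert function of `K^{I,J}_[p]`, `p ≥ 0`: the length of the piece of bidegree
`(p + 1 + n, n)` of the kernel of `π`. -/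
def kHilb {I J : Ideal R} (hJI : J ≤ I) {d : ℕ} (a : Fin d → ↥J) (p n : ℕ) : ℕ∞ :=
  Module.length R ↥(kerPiece hJI a (p + 1) n)

/-- The piece of bidegree `(m, j)` of `K^{I,J} = ⨁_{p ≥ 0} K^{I,J}_[p]`, where `M_[p]` is the
direct sum of the pieces `M_(m,j)` with `m - j = p + 1`. -/
def kPiece {I J : Ideal R} (hJI : J ≤ I) {d : ℕ} (a : Fin d → ↥J) (m j : ℕ) :
    Submodule R (CRing I J d) :=
  if j < m then kerPiece hJI a (m - j) j else ⊥

/-- The bigraded Hilbert function `h_K(m,n) = ∑_{j ≤ n} length K_(m,j)` of `K^{I,J}`. -/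
def kBigradedHilb {I J : Ideal R} (hJI : J ≤ I) {d : ℕ} (a : Fin d → ↥J) (m n : ℕ) : ℕ∞ :=
  ∑ j ∈ Finset.range (n + 1), Module.length R ↥(kPiece hJI a m j)

/-- The multiplicity `e_0(Σ^{I,J}_[p])`, with respect to the degree `d - 1`. -/
def e0Sigma (d : ℕ) (I J : Ideal R) (p : ℕ) : ℤ := hilbertCoeff d (sigmaHilb I J p) 0

/-- `δ_p(I,J) = e_0(K^{I,J}_[p])`, with respect to the degree `d - 1`. -/
def deltaLoc {I J : Ideal R} (hJI : J ≤ I) {d : ℕ} (a : Fin d → ↥J) (p : ℕ) : ℤ :=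
  hilbertCoeff d (kHilb hJI a p) 0

/-- The multiplicity `e_0(K^{I,J})` of the bigraded module `K^{I,J}`, with respect to the
degree `d - 1`. -/
def e0K {I J : Ideal R} (hJI : J ≤ I) {d : ℕ} (a : Fin d → ↥J) : ℤ :=
  bigradedHilbertCoeff d (kBigradedHilb hJI a) 0

end

end BigradedSally

end

/-! Write λ for length, d for the dimension, r for an exponent with I^(r+1) = J I^r.

In degree n, Σ_[p] is J^n I^(p+1) / J^(n+1) I^p, and the matching piece of C has length Λ_p
binom(n+d-1, d-1), one copy of I^(p+1) / J I^p for each monomial of degree n. Since π is onto on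
each piece, the Hilbert function of K_[p] is the difference of the two. Comparing leading
coefficients gives δ_p = Λ_p - e_0(Σ_[p]); δ_p and e_0(Σ_[p]) are nonnegative because lengths are.
The Hilbert function of Σ_[p] is of polynomial type by the Hilbert-Serre argument
(`isHP_length_of_acc`), Σ_[p] being a graded subquotient of the Rees algebra of J.

For e_1, the factors of the chain J^(n+1) ⊆ J^n I ⊆ … ⊆ I^(n+1) are the pieces of Σ_[p] in degree n
- p (`sum_sigmaHilb`). Cohen-Macaulayness makes the generators of J a regular sequence
(`isWeaklyRegular_of_parameters`), so λ(R/J^(n+1)) = λ(R/J) binom(n+d, d)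
(`length_quotient_pow_sup`). Hence λ(R/I^(n+1)) is this leading term minus the sum of the functions
of the Σ_[p], and e_1 is the sum of the e_0(Σ_[p]). Only p < r contributes, so all sums are finite.
Summing K_[p] along the diagonals m - j = p + 1 gives e_0(K) in the same way.

For δ_p ≤ Δ_p put Q = I^(p+1) + J, so that Λ_p - Δ_p = λ(Q/J). The piece of Σ_[p] in degree n maps
onto J^n Q / J^(n+1). Since λ(J^n/J^(n+1)) = λ(R/J) binom(n+d-1, d-1) and λ(J^n/J^n Q) ≤ λ(R/Q)
binom(n+d-1, d-1), that image has length at least (Λ_p - Δ_p) binom(n+d-1, d-1)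
(`LambdaLoc_sub_DeltaLoc_le`). So e_0(Σ_[p]) ≥ Λ_p - Δ_p.

In the lemmas on leading coefficients the dimension is `d + 1`, so that the relevant degree is `d`.
-/

noncomputable section

namespace BigradedSally

/-! ### Numerical polynomials -/

/-- `f` agrees for large arguments with an integral combination of the functions
`n ↦ binom(n + k, k)`, `k < d`. -/
def IsHP (d : ℕ) (f : ℕ → ℤ) : Prop :=
  ∃ c : ℕ → ℤ, ∀ᶠ n in atTop, f n = ∑ k ∈ Finset.range d, c k * ((n + k).choose k : ℤ)

/-- `f` agrees for large arguments with `c * binom(n + d, d)` up to terms of lower degree. -/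
def IsHPLead (d : ℕ) (c : ℤ) (f : ℕ → ℤ) : Prop :=
  IsHP d fun n => f n - c * ((n + d).choose d : ℤ)

theorem IsHP.congr {d : ℕ} {f g : ℕ → ℤ} (hf : IsHP d f) (h : ∀ᶠ n in atTop, g n = f n) :
    IsHP d g := by
  obtain ⟨c, hc⟩ := hf
  exact ⟨c, by filter_upwards [hc, h] with n h1 h2; rw [h2, h1]⟩

theorem IsHP.zero (d : ℕ) : IsHP d fun _ => 0 := ⟨0, by simp⟩

theorem IsHP.add {d : ℕ} {f g : ℕ → ℤ} (hf : IsHP d f) (hg : IsHP d g) :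
    IsHP d fun n => f n + g n := by
  obtain ⟨c, hc⟩ := hf
  obtain ⟨c', hc'⟩ := hg
  refine ⟨fun k => c k + c' k, ?_⟩
  filter_upwards [hc, hc'] with n h1 h2
  rw [h1, h2, ← Finset.sum_add_distrib]
  exact Finset.sum_congr rfl fun k _ => by ring

theorem IsHP.const_mul {d : ℕ} {f : ℕ → ℤ} (a : ℤ) (hf : IsHP d f) :
    IsHP d fun n => a * f n := by
  obtain ⟨c, hc⟩ := hf
  refine ⟨fun k => a * c k, ?_⟩
  filter_upwards [hc] with n h1
  rw [h1, Finset.mul_sum]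
  exact Finset.sum_congr rfl fun k _ => by ring

theorem IsHP.sub {d : ℕ} {f g : ℕ → ℤ} (hf : IsHP d f) (hg : IsHP d g) :
    IsHP d fun n => f n - g n :=
  (hf.add (hg.const_mul (-1))).congr (by simp [sub_eq_add_neg])

theorem IsHP.sum {ι : Type*} {d : ℕ} (s : Finset ι) {f : ι → ℕ → ℤ}
    (hf : ∀ i ∈ s, IsHP d (f i)) : IsHP d fun n => ∑ i ∈ s, f i n := by
  classical
  induction s using Finset.induction_on with
  | empty => simpa using IsHP.zero d
  | insert i s hi ih =>
    simp only [Finset.sum_insert hi]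
    exact (hf i (by simp)).add (ih fun j hj => hf j (by simp [hj]))

theorem IsHP.choose {k d : ℕ} (h : k < d) : IsHP d fun n => ((n + k).choose k : ℤ) :=
  ⟨fun j => if j = k then 1 else 0, by simp [h]⟩

theorem IsHP.mono {d d' : ℕ} (h : d ≤ d') {f : ℕ → ℤ} (hf : IsHP d f) : IsHP d' f := by
  obtain ⟨c, hc⟩ := hf
  exact IsHP.congr (IsHP.sum (Finset.range d) (f := fun k n => c k * ((n + k).choose k : ℤ))
    fun k hk => (IsHP.choose (lt_of_lt_of_le (Finset.mem_range.mp hk) h)).const_mul _) hc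

theorem IsHPLead.isHP {d : ℕ} {c : ℤ} {f : ℕ → ℤ} (hf : IsHPLead d c f) : IsHP (d + 1) f :=
  ((hf.mono d.le_succ).add ((IsHP.choose d.lt_succ_self).const_mul c)).congr (by simp)

theorem IsHP.exists_lead {d : ℕ} {f : ℕ → ℤ} (hf : IsHP (d + 1) f) : ∃ c, IsHPLead d c f := by
  obtain ⟨c, hc⟩ := hf
  refine ⟨c d, c, ?_⟩
  filter_upwards [hc] with n h1
  rw [h1, Finset.sum_range_succ]
  ring

theorem IsHPLead.congr {d : ℕ} {c : ℤ} {f g : ℕ → ℤ} (hf : IsHPLead d c f)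
    (h : ∀ᶠ n in atTop, g n = f n) : IsHPLead d c g :=
  IsHP.congr hf (by filter_upwards [h] with n hn; rw [hn])

theorem IsHPLead.choose (d : ℕ) : IsHPLead d 1 fun n => ((n + d).choose d : ℤ) :=
  (IsHP.zero d).congr (by simp)

theorem IsHPLead.const_mul {d : ℕ} {c : ℤ} {f : ℕ → ℤ} (a : ℤ) (hf : IsHPLead d c f) :
    IsHPLead d (a * c) fun n => a * f n :=
  (IsHP.const_mul a hf).congr (Eventually.of_forall fun n => by ring)

theorem IsHPLead.add {d : ℕ} {c c' : ℤ} {f g : ℕ → ℤ} (hf : IsHPLead d c f)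
    (hg : IsHPLead d c' g) : IsHPLead d (c + c') fun n => f n + g n :=
  (IsHP.add hf hg).congr (Eventually.of_forall fun n => by ring)

theorem IsHPLead.sub {d : ℕ} {c c' : ℤ} {f g : ℕ → ℤ} (hf : IsHPLead d c f)
    (hg : IsHPLead d c' g) : IsHPLead d (c - c') fun n => f n - g n :=
  (IsHP.sub hf hg).congr (Eventually.of_forall fun n => by ring)

theorem IsHPLead.sum {ι : Type*} {d : ℕ} (s : Finset ι) {c : ι → ℤ} {f : ι → ℕ → ℤ}
    (hf : ∀ i ∈ s, IsHPLead d (c i) (f i)) :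
    IsHPLead d (∑ i ∈ s, c i) fun n => ∑ i ∈ s, f i n :=
  (IsHP.sum s hf).congr (Eventually.of_forall fun n => by
    rw [Finset.sum_sub_distrib, Finset.sum_mul])

theorem choose_succ_add_succ (n k : ℕ) :
    ((n + 1 + (k + 1)).choose (k + 1) : ℤ) =
      (n + (k + 1)).choose (k + 1) + (n + 1 + k).choose k := by
  rw [show n + 1 + (k + 1) = (n + 1 + k) + 1 by ring, Nat.choose_succ_succ,
    show n + 1 + k = n + (k + 1) by ring]
  push_cast
  ring

/-- By Pascal's rule the shift changes the binomial only by one of lower degree. The truncation of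
`n - 1` matters only at n = 0. -/
theorem IsHPLead.choose_shift_sub (d : ℕ) :
    IsHPLead d 1 fun n => ((n - 1 + d).choose d : ℤ) := by
  cases d with
  | zero => exact (IsHP.zero 0).congr (by simp)
  | succ d =>
    refine ((IsHP.choose d.lt_succ_self).const_mul (-1)).congr ?_
    filter_upwards [eventually_ge_atTop 1] with n hn
    obtain ⟨n, rfl⟩ := Nat.exists_eq_add_of_le' hn
    rw [choose_succ_add_succ]
    simp

theorem IsHP.shift_sub {d : ℕ} {f : ℕ → ℤ} (hf : IsHP d f) : IsHP d fun n => f (n - 1) := by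
  obtain ⟨c, hc⟩ := hf
  refine IsHP.congr (IsHP.sum (Finset.range d)
    (f := fun k n => c k * ((n - 1 + k).choose k : ℤ)) fun k hk => ?_)
    ((tendsto_sub_atTop_nat 1).eventually hc)
  exact ((IsHPLead.choose_shift_sub k).isHP.mono (Finset.mem_range.mp hk)).const_mul _

theorem IsHPLead.shift_sub_one {d : ℕ} {c : ℤ} {f : ℕ → ℤ} (hf : IsHPLead d c f) :
    IsHPLead d c fun n => f (n - 1) :=
  ((IsHP.shift_sub hf).add (IsHP.const_mul c (IsHPLead.choose_shift_sub d))).congr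
    (Eventually.of_forall fun n => by ring)

theorem IsHPLead.shift_sub {d : ℕ} {c : ℤ} {f : ℕ → ℤ} (hf : IsHPLead d c f) (p : ℕ) :
    IsHPLead d c fun n => f (n - p) := by
  induction p with
  | zero => simpa using hf
  | succ p ih =>
    exact ih.shift_sub_one.congr (Eventually.of_forall fun n => by
      rw [Nat.sub_sub, Nat.add_comm 1 p])

/-- Pascal's rule exhibits binom(n+1+k, k) as the difference of n ↦ binom(n+k+1, k+1). Summing the
expansion of the difference therefore recovers `f` up to an eventual constant. -/
theorem IsHP.of_sub {d : ℕ} {f : ℕ → ℤ} (hf : IsHP d fun n => f (n + 1) - f n) :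
    IsHP (d + 1) f := by
  -- Shifting back and forth expands f(n+1) - f(n) in the functions binom(n+1+k, k), the form that
  -- Pascal's rule produces.
  obtain ⟨c, hc⟩ := hf.shift_sub
  have hc' := (tendsto_add_atTop_nat 1).eventually hc
  simp only [Nat.add_sub_cancel] at hc'
  set F : ℕ → ℤ := fun n => f n - ∑ k ∈ Finset.range d, c k * ((n + (k + 1)).choose (k + 1) : ℤ)
    with hF
  obtain ⟨N, hN⟩ := eventually_atTop.mp hc'
  have hconst : ∀ n ≥ N, F n = F N := by
    intro n hn
    induction n, hn using Nat.le_induction with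
    | base => rfl
    | succ n hn ih =>
      rw [← ih]
      have h1 := hN n hn
      have h2 : ∑ k ∈ Finset.range d, c k * ((n + 1 + (k + 1)).choose (k + 1) : ℤ) =
          ∑ k ∈ Finset.range d, c k * ((n + (k + 1)).choose (k + 1) : ℤ) +
          ∑ k ∈ Finset.range d, c k * ((n + 1 + k).choose k : ℤ) := by
        rw [← Finset.sum_add_distrib]
        exact Finset.sum_congr rfl fun k _ => by rw [choose_succ_add_succ]; ring
      simp only [hF]
      rw [h2, ← h1]
      ring
  refine IsHP.congr (IsHP.add (IsHP.sum (Finset.range d)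
    (f := fun k n => c k * ((n + (k + 1)).choose (k + 1) : ℤ)) fun k hk =>
      (IsHP.choose (by simpa using hk)).const_mul _)
    ((IsHP.choose (d := d + 1) (k := 0) (by omega)).const_mul (F N))) ?_
  filter_upwards [eventually_ge_atTop N] with n hn
  rw [← hconst n hn]
  simp [hF]

/-- For d > 0, `f` is at most C binom(n+d-1, d-1) with C = ∑ |c k|, whereas binom(n+d, d) is (n+d)/d
times binom(n+d-1, d-1). Hence n ≥ C d suffices. -/
theorem IsHP.eventually_lt {d : ℕ} {f : ℕ → ℤ} (hf : IsHP d f) :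
    ∀ᶠ n in atTop, f n < ((n + d).choose d : ℤ) := by
  obtain ⟨c, hc⟩ := hf
  rcases d with - | d
  · filter_upwards [hc] with n hn
    simp [hn]
  set C : ℤ := ∑ k ∈ Finset.range (d + 1), |c k| with hC
  have hC0 : 0 ≤ C := Finset.sum_nonneg fun k _ => abs_nonneg _
  filter_upwards [hc, eventually_ge_atTop (C.toNat * (d + 1))] with n hn hn'
  have hb : f n ≤ C * ((n + d).choose d : ℤ) := by
    rw [hn, hC, Finset.sum_mul]
    refine Finset.sum_le_sum fun k hk => ?_
    have hk' : (n + k).choose k ≤ (n + d).choose d := by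
      rw [← Nat.choose_symm_add, ← Nat.choose_symm_add (a := n) (b := d)]
      exact Nat.choose_le_choose _ (by have := Finset.mem_range.mp hk; omega)
    calc c k * ((n + k).choose k : ℤ) ≤ |c k| * ((n + k).choose k : ℤ) :=
          mul_le_mul_of_nonneg_right (le_abs_self _) (by positivity)
      _ ≤ |c k| * ((n + d).choose d : ℤ) :=
          mul_le_mul_of_nonneg_left (by exact_mod_cast hk') (abs_nonneg _)
  have hmul : ((d : ℤ) + 1) * ((n + (d + 1)).choose (d + 1) : ℤ) =
      (n + d + 1) * ((n + d).choose d : ℤ) := by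
    have := Nat.add_one_mul_choose_eq (n + d) d
    rw [← Nat.add_assoc]
    have h := congrArg (Nat.cast : ℕ → ℤ) this
    push_cast at h
    linarith
  have hpos : (0 : ℤ) < ((n + d).choose d : ℤ) := by
    exact_mod_cast Nat.choose_pos (Nat.le_add_left d n)
  have hn'' : C * (d + 1) ≤ n := by
    have : ((C.toNat * (d + 1) : ℕ) : ℤ) ≤ n := by exact_mod_cast hn'
    rwa [Nat.cast_mul, Int.toNat_of_nonneg hC0, Nat.cast_add, Nat.cast_one] at this
  have hlt : ((d : ℤ) + 1) * (C * ((n + d).choose d : ℤ)) <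
      (d + 1) * ((n + (d + 1)).choose (d + 1) : ℤ) := by
    rw [hmul]
    nlinarith
  exact lt_of_le_of_lt hb (lt_of_mul_lt_mul_left hlt (by positivity))

theorem IsHPLead.nonneg {d : ℕ} {c : ℤ} {f : ℕ → ℤ} (hf : IsHPLead d c f)
    (h : ∀ᶠ n in atTop, 0 ≤ f n) : 0 ≤ c := by
  by_contra! hc
  obtain ⟨n, h1, h2⟩ := (h.and (IsHP.eventually_lt hf)).exists
  have : (0 : ℤ) < ((n + d).choose d : ℤ) := by
    exact_mod_cast Nat.choose_pos (Nat.le_add_left d n)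
  nlinarith

theorem IsHPLead.le {d : ℕ} {c c' : ℤ} {f g : ℕ → ℤ} (hf : IsHPLead d c f)
    (hg : IsHPLead d c' g) (h : ∀ᶠ n in atTop, f n ≤ g n) : c ≤ c' :=
  sub_nonneg.mp ((hg.sub hf).nonneg (by filter_upwards [h] with n hn; linarith))

theorem IsHPLead.unique {d : ℕ} {c c' : ℤ} {f : ℕ → ℤ} (hf : IsHPLead d c f)
    (hg : IsHPLead d c' f) : c = c' :=
  le_antisymm (hf.le hg (by simp)) (hg.le hf (by simp))

/-! ### Hilbert coefficients of numerical polynomials -/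

theorem sum_hilbertCoeffs_eq (d : ℕ) (e : ℕ → ℤ) (n : ℕ) :
    ∑ j ∈ Finset.range d, (-1 : ℤ) ^ j * e j * ((n + (d - 1 - j)).choose (d - 1 - j) : ℤ) =
      ∑ k ∈ Finset.range d, (-1 : ℤ) ^ (d - 1 - k) * e (d - 1 - k) * ((n + k).choose k : ℤ) := by
  rw [← Finset.sum_range_reflect]
  refine Finset.sum_congr rfl fun k hk => ?_
  have := Finset.mem_range.mp hk
  rw [show d - 1 - (d - 1 - k) = k by omega]

theorem IsHP.exists_coeffs {d : ℕ} {f : ℕ → ℤ} (hf : IsHP d f) :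
    ∃ e : ℕ → ℤ, ∀ᶠ n in atTop, f n = ∑ j ∈ Finset.range d,
      (-1 : ℤ) ^ j * e j * ((n + (d - 1 - j)).choose (d - 1 - j) : ℤ) := by
  obtain ⟨c, hc⟩ := hf
  refine ⟨fun j => (-1) ^ j * c (d - 1 - j), ?_⟩
  filter_upwards [hc] with n hn
  rw [hn, sum_hilbertCoeffs_eq]
  refine Finset.sum_congr rfl fun k hk => ?_
  have := Finset.mem_range.mp hk
  rw [show d - 1 - (d - 1 - k) = k by omega, ← mul_assoc, ← pow_add, ← two_mul, pow_mul]
  simp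

theorem isHPLead_of_coeffs {d : ℕ} {e : ℕ → ℤ} {f : ℕ → ℤ}
    (h : ∀ᶠ n in atTop, f n = ∑ j ∈ Finset.range (d + 1),
      (-1 : ℤ) ^ j * e j * ((n + (d + 1 - 1 - j)).choose (d + 1 - 1 - j) : ℤ)) :
    IsHPLead d (e 0) f := by
  refine ⟨fun k => (-1 : ℤ) ^ (d - k) * e (d - k), ?_⟩
  filter_upwards [h] with n hn
  rw [hn, sum_hilbertCoeffs_eq, Finset.sum_range_succ]
  simp

/-- The coefficient e_1 carries the sign -1, so it leads the function obtained by subtracting `f`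
from its top term. -/
theorem isHPLead_one_of_coeffs {d : ℕ} {e : ℕ → ℤ} {f : ℕ → ℤ}
    (h : ∀ᶠ n in atTop, f n = ∑ j ∈ Finset.range (d + 1 + 1),
      (-1 : ℤ) ^ j * e j * ((n + (d + 1 + 1 - 1 - j)).choose (d + 1 + 1 - 1 - j) : ℤ)) :
    IsHPLead d (e 1) fun n => e 0 * ((n + (d + 1)).choose (d + 1) : ℤ) - f n := by
  refine ⟨fun k => - ((-1 : ℤ) ^ (d + 1 - k) * e (d + 1 - k)), ?_⟩
  filter_upwards [h] with n hn
  rw [hn, sum_hilbertCoeffs_eq, Finset.sum_range_succ, Finset.sum_range_succ]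
  simp

theorem exists_isHilbertCoeffs {d : ℕ} {h : ℕ → ℕ∞} {f : ℕ → ℤ}
    (hf : ∀ᶠ n in atTop, ∃ k : ℕ, h n = k ∧ (k : ℤ) = f n) (hP : IsHP d f) :
    ∃ e, IsHilbertCoeffs d h e := by
  obtain ⟨e, he⟩ := hP.exists_coeffs
  refine ⟨e, ?_⟩
  filter_upwards [hf, he] with n ⟨k, hk, hk'⟩ hn
  exact ⟨k, hk, by rw [hk', hn]⟩

theorem IsHilbertCoeffs.eventually_eq {d : ℕ} {h : ℕ → ℕ∞} {f e : ℕ → ℤ}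
    (he : IsHilbertCoeffs d h e) (hf : ∀ᶠ n in atTop, ∃ k : ℕ, h n = k ∧ (k : ℤ) = f n) :
    ∀ᶠ n in atTop, f n = ∑ j ∈ Finset.range d,
      (-1 : ℤ) ^ j * e j * ((n + (d - 1 - j)).choose (d - 1 - j) : ℤ) := by
  filter_upwards [hf, he] with n ⟨k, hk, hk'⟩ ⟨l, hl, hl'⟩
  have : k = l := by exact_mod_cast hk.symm.trans hl
  rw [← hk', ← hl', this]

/-- Leading coefficients are unique by comparison of growth, so the choice made in `hilbertCoeff`
does not affect the value. -/
theorem hilbertCoeff_zero_eq {d : ℕ} {h : ℕ → ℕ∞} {f : ℕ → ℤ} {c : ℤ}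
    (hf : ∀ᶠ n in atTop, ∃ k : ℕ, h n = k ∧ (k : ℤ) = f n) (hP : IsHPLead d c f) :
    hilbertCoeff (d + 1) h 0 = c := by
  have H := exists_isHilbertCoeffs hf hP.isHP
  rw [hilbertCoeff, dif_pos H]
  exact (isHPLead_of_coeffs (H.choose_spec.eventually_eq hf)).unique hP

theorem hilbertCoeff_one_eq {d : ℕ} {h : ℕ → ℕ∞} {f g : ℕ → ℤ} {b c : ℤ}
    (hf : ∀ᶠ n in atTop, ∃ k : ℕ, h n = k ∧ (k : ℤ) = f n)
    (hfg : ∀ᶠ n in atTop, f n = b * ((n + (d + 1)).choose (d + 1) : ℤ) - g n)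
    (hP : IsHPLead d c g) :
    (∃ e, IsHilbertCoeffs (d + 1 + 1) h e) ∧ hilbertCoeff (d + 1 + 1) h 1 = c := by
  have hb : IsHPLead (d + 1) b f :=
    (IsHP.const_mul (-1) hP.isHP).congr (by filter_upwards [hfg] with n hn; rw [hn]; ring)
  have H := exists_isHilbertCoeffs hf hb.isHP
  refine ⟨H, ?_⟩
  rw [hilbertCoeff, dif_pos H]
  have h1 := H.choose_spec.eventually_eq hf
  -- The chosen e_0 must be identified with `b` before the next coefficient can be compared.
  have h0 := (isHPLead_of_coeffs h1).unique hb
  refine (isHPLead_one_of_coeffs h1).unique (hP.congr ?_)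
  filter_upwards [hfg] with n hn
  rw [h0, hn]
  ring

theorem bigradedHilbertCoeff_zero_eq {d N : ℕ} {h : ℕ → ℕ → ℕ∞} {f : ℕ → ℤ} {c : ℤ}
    (hf : ∀ m ≥ N, ∀ n ≥ m, ∃ k : ℕ, h m n = k ∧ (k : ℤ) = f m) (hP : IsHPLead d c f) :
    (∃ e, IsBigradedHilbertCoeffs (d + 1) h e) ∧ bigradedHilbertCoeff (d + 1) h 0 = c := by
  have H : ∃ e, IsBigradedHilbertCoeffs (d + 1) h e := by
    obtain ⟨e, he⟩ := hP.isHP.exists_coeffs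
    obtain ⟨m₀, hm⟩ := eventually_atTop.mp he
    refine ⟨e, max m₀ N, 0, fun m hm' n hn => ?_⟩
    obtain ⟨k, hk, hk'⟩ := hf m (le_of_max_le_right hm') n hn
    exact ⟨k, hk, by rw [hk', hm m (le_of_max_le_left hm')]⟩
  refine ⟨H, ?_⟩
  rw [bigradedHilbertCoeff, dif_pos H]
  obtain ⟨m₀, n₀, he⟩ := H.choose_spec
  -- The polynomial depends on m alone, so it is determined by the values on the line n = m + n₀.
  refine (isHPLead_of_coeffs ?_).unique hP
  filter_upwards [eventually_ge_atTop (max m₀ N)] with m hm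
  obtain ⟨k, hk, hk'⟩ := hf m (le_of_max_le_right hm) (m + n₀) (by omega)
  obtain ⟨l, hl, hl'⟩ := he m (le_of_max_le_left hm) (m + n₀) le_rfl
  have : k = l := by exact_mod_cast hk.symm.trans hl
  rw [← hk', ← hl', this]

/-! ### The theorem of Hilbert and Serre -/

/-- The Hilbert function of a graded module over a polynomial ring in `d` variables, given by its
pieces `M n` and the multiplications `x i` by the variables, is of polynomial type of degree less
than `d`, provided that the pieces have finite length and that the ascending chain condition holds
for graded submodules. -/
theorem isHP_length_of_acc {R : Type*} [CommRing R] (d : ℕ) (M : ℕ → Type*)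
    [∀ n, AddCommGroup (M n)] [∀ n, Module R (M n)] (x : Fin d → ∀ n, M n →ₗ[R] M (n + 1))
    (hcomm : ∀ i j n m, x i (n + 1) (x j n m) = x j (n + 1) (x i n m))
    (hfin : ∀ n, Module.length R (M n) ≠ ⊤)
    (hacc : ∀ f : ℕ → ∀ n, Submodule R (M n), Monotone f →
      (∀ k i n m, m ∈ f k n → x i n m ∈ f k (n + 1)) → ∃ k₀, ∀ k ≥ k₀, f k = f k₀) :
    IsHP d fun n => ((Module.length R (M n)).toNat : ℤ) := by
  induction d generalizing M with
  | zero =>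
    -- With no variables every family of submodules is graded. The chain of truncations below degree
    -- k stabilizes only if the pieces vanish from some degree on.
    obtain ⟨k₀, hk⟩ := hacc (fun k n => if n < k then ⊤ else ⊥)
      (fun k l hkl n => by
        dsimp only
        split_ifs with h1 h2
        · exact le_rfl
        · omega
        · exact bot_le
        · exact le_rfl) (fun _ i => i.elim0)
    refine (IsHP.zero 0).congr ?_
    filter_upwards [eventually_ge_atTop k₀] with n hn
    have h := congrFun (hk (n + 1) (by omega)) n
    simp only [Nat.lt_succ_self, if_true, if_neg (not_lt.mpr hn)] at h
    have : Subsingleton (M n) := by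
      rw [← Submodule.subsingleton_iff R]
      exact subsingleton_of_bot_eq_top h.symm
    simp [Module.length_eq_zero]
  | succ d ih =>
    apply IsHP.of_sub
    -- The variable `x 0` acts as zero on its own kernel and cokernel, so both are modules over the
    -- remaining `d` variables.
    have hK := ih (fun n => ↥(LinearMap.ker (x 0 n)))
      (fun i n => (x i.succ n).restrict fun m hm => by
        rw [LinearMap.mem_ker] at hm ⊢
        rw [hcomm, hm, map_zero])
      (fun i j n m => Subtype.ext (hcomm _ _ _ _))
      (fun n => ne_top_of_le_ne_top (hfin n)
        (Module.length_le_of_injective _ (Submodule.subtype_injective _)))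
      (fun f hf hst => by
        obtain ⟨k₀, hk⟩ := hacc (fun k n => (f k n).map (Submodule.subtype _))
          (fun k l hkl n => Submodule.map_mono (hf hkl n)) (fun k i n m hm => by
            obtain ⟨z, hz, rfl⟩ := hm
            refine Fin.cases ?_ (fun i => ?_) i
            · have : x 0 n (z : M n) = 0 := z.2
              simp only [Submodule.coe_subtype]
              rw [this]
              exact Submodule.zero_mem _
            · exact ⟨_, hst k i n z hz, rfl⟩)
        refine ⟨k₀, fun k hk' => funext fun n => ?_⟩
        exact Submodule.map_injective_of_injective (Submodule.subtype_injective _)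
          (congrFun (hk k hk') n))
    have hC := ih (fun n => M (n + 1) ⧸ LinearMap.range (x 0 n))
      (fun i n => Submodule.mapQ _ _ (x i.succ (n + 1)) (by
        rintro _ ⟨m, rfl⟩
        exact ⟨x i.succ n m, hcomm _ _ _ _⟩))
      (fun i j n m => by
        obtain ⟨m, rfl⟩ := Submodule.mkQ_surjective _ m
        simp only [Submodule.mkQ_apply, Submodule.mapQ_apply]
        rw [hcomm])
      (fun n => ne_top_of_le_ne_top (hfin (n + 1))
        (Module.length_le_of_surjective _ (Submodule.mkQ_surjective _)))
      (fun f hf hst => by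
        -- The cokernel with index n lives in degree n + 1, so degree 0 is filled with `⊥`. The
        -- preimages contain the image of `x 0` and are thus stable under it.
        obtain ⟨k₀, hk⟩ := hacc (fun k n => match n with
            | 0 => ⊥
            | n + 1 => (f k n).comap (Submodule.mkQ _))
          (fun k l hkl n => by
            cases n with
            | zero => exact le_rfl
            | succ n => exact Submodule.comap_mono (hf hkl n))
          (fun k i n m hm => by
            cases n with
            | zero =>
              rw [(Submodule.mem_bot R).mp hm, map_zero]
              exact Submodule.zero_mem _
            | succ n =>
              refine Fin.cases ?_ (fun i => ?_) i
              · change Submodule.Quotient.mk _ ∈ f k (n + 1)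
                rw [(Submodule.Quotient.mk_eq_zero (LinearMap.range (x 0 (n + 1)))).mpr
                  (LinearMap.mem_range_self _ m)]
                exact Submodule.zero_mem _
              · exact hst k i n _ hm)
        refine ⟨k₀, fun k hk' => funext fun n => ?_⟩
        exact Submodule.comap_injective_of_surjective (Submodule.mkQ_surjective _)
          (congrFun (hk k hk') (n + 1)))
    -- The exact sequence 0 → ker → M n → M (n+1) → coker → 0 turns the first difference of lengths
    -- into λ(coker) - λ(ker).
    refine (hC.sub hK).congr (Eventually.of_forall fun n => ?_)
    have h1 := Module.length_eq_add_of_exact (LinearMap.ker (x 0 n)).subtype (x 0 n).rangeRestrict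
      (Submodule.subtype_injective _) (LinearMap.surjective_rangeRestrict _)
      (by
        rw [LinearMap.exact_iff, Submodule.range_subtype, LinearMap.ker_rangeRestrict])
    have h2 := Module.length_eq_add_of_exact (LinearMap.range (x 0 n)).subtype
      (LinearMap.range (x 0 n)).mkQ (Submodule.subtype_injective _) (Submodule.mkQ_surjective _)
      (LinearMap.exact_subtype_mkQ _)
    have hM := hfin n
    have hM' := hfin (n + 1)
    rw [h1, Ne, ENat.add_eq_top, not_or] at hM
    rw [h2, Ne, ENat.add_eq_top, not_or] at hM'
    rw [h1, h2, ENat.toNat_add hM.1 hM.2, ENat.toNat_add hM'.1 hM'.2]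
    push_cast
    ring

/-- The homogeneous ideal `⨁ G m t^m` of the Rees algebra of `I`. -/
def reesGradedIdeal {R : Type*} [CommRing R] (I : Ideal R) (G : ℕ → Ideal R)
    (hG : ∀ k m, I ^ k * G m ≤ G (k + m)) : Ideal ↥(reesAlgebra I) where
  carrier := {F | ∀ n, (F : R[X]).coeff n ∈ G n}
  add_mem' := fun {F F'} hF hF' n => by simpa using Ideal.add_mem _ (hF n) (hF' n)
  zero_mem' := fun n => by simp
  smul_mem' := fun F' F hF n => by
    simp only [smul_eq_mul, MulMemClass.coe_mul, coeff_mul]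
    refine Ideal.sum_mem _ fun p hp => ?_
    rw [← Finset.HasAntidiagonal.mem_antidiagonal.mp hp]
    exact hG _ _ (Ideal.mul_mem_mul (F'.2 p.1) (hF p.2))

/-- The graded subquotient `⨁ A n / B n` of the Rees algebra of `J = (a_1, …, a_d)` has a Hilbert
function of polynomial type of degree less than `d`. -/
theorem isHP_quotLength {R : Type*} [CommRing R] [IsNoetherianRing R] {d : ℕ} (a : Fin d → R)
    {J : Ideal R} (hJ : Ideal.span (Set.range a) = J) (A B : ℕ → Ideal R)
    (hA : ∀ n, A n ≤ J ^ n) (hJA : ∀ n, J * A n ≤ A (n + 1)) (hJB : ∀ n, J * B n ≤ B (n + 1))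
    (hfin : ∀ n, quotLength (A n) (B n) ≠ ⊤) :
    IsHP d fun n => ((quotLength (A n) (B n)).toNat : ℤ) := by
  have ha : ∀ i, a i ∈ J := fun i => hJ ▸ Ideal.subset_span ⟨i, rfl⟩
  refine isHP_length_of_acc d (fun n => ↥(A n) ⧸ Submodule.comap (A n).subtype (B n))
    (fun i n => Submodule.mapQ _ _ ((LinearMap.lsmul R R (a i)).restrict
      (p := A n) (q := A (n + 1)) fun c hc => hJA n (Ideal.mul_mem_mul (ha i) hc))
      fun c hc => hJB n (Ideal.mul_mem_mul (ha i) hc)) ?_ hfin ?_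
  · intro i j n m
    obtain ⟨m, rfl⟩ := Submodule.mkQ_surjective _ m
    simp only [Submodule.mkQ_apply, Submodule.mapQ_apply]
    congr 1
    exact Subtype.ext (mul_left_comm _ _ _)
  · intro f hf hst
    -- A graded submodule of ⨁ A n / B n lifts to the homogeneous ideal ⨁ `Lf k n` t^n of the Rees
    -- algebra of J. That ring is Noetherian, which supplies the chain condition.
    set Lf : ℕ → ℕ → Ideal R := fun k n => ((f k n).comap (Submodule.mkQ _)).map (A n).subtype
      with hLf
    have hst' : ∀ k n, J * Lf k n ≤ Lf k (n + 1) := by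
      intro k n
      rw [← hJ, Ideal.mul_le]
      intro r hr s hs
      induction hr using Submodule.span_induction with
      | mem r hr =>
        obtain ⟨i, rfl⟩ := hr
        obtain ⟨c, hc, rfl⟩ := hs
        exact ⟨_, hst k i n _ hc, rfl⟩
      | zero => simp
      | add r r' _ _ h h' =>
        rw [add_mul]
        exact Ideal.add_mem _ h h'
      | smul t r _ h =>
        rw [smul_eq_mul, mul_assoc]
        exact Ideal.mul_mem_left _ _ h
    have hpow : ∀ k m n, J ^ m * Lf k n ≤ Lf k (m + n) := by
      intro k m n
      induction m with
      | zero => simp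
      | succ m ih =>
        rw [pow_succ', mul_assoc, show m + 1 + n = m + n + 1 by ring]
        exact (Ideal.mul_mono_right ih).trans (hst' k _)
    let T : ℕ →o Ideal ↥(reesAlgebra J) :=
      { toFun := fun k => reesGradedIdeal J (Lf k) (hpow k)
        monotone' := fun k l hkl F hF n =>
          Submodule.map_mono (Submodule.comap_mono (hf hkl n)) (hF n) }
    obtain ⟨k₀, hk₀⟩ := monotone_stabilizes_iff_noetherian.mpr
      (inferInstance : IsNoetherian ↥(reesAlgebra J) ↥(reesAlgebra J)) T
    have hrec : ∀ k n c, c ∈ Lf k n ↔ ∃ h : monomial n c ∈ reesAlgebra J,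
        (⟨monomial n c, h⟩ : ↥(reesAlgebra J)) ∈ T k := by
      intro k n c
      constructor
      · intro hc
        refine ⟨reesAlgebra.monomial_mem.mpr (hA n ?_), fun m => ?_⟩
        · obtain ⟨z, -, rfl⟩ := hc
          exact z.2
        · simp only [coeff_monomial]
          split_ifs with h
          · exact h ▸ hc
          · exact Ideal.zero_mem _
      · rintro ⟨h, hT⟩
        simpa using hT n
    refine ⟨k₀, fun k hk => funext fun n => ?_⟩
    apply Submodule.comap_injective_of_surjective (Submodule.mkQ_surjective _)
    apply Submodule.map_injective_of_injective (A n).subtype_injective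
    change Lf k n = Lf k₀ n
    ext c
    rw [hrec, hrec, hk₀ k hk]

/-! ### Systems of parameters of Cohen-Macaulay modules are regular sequences -/

section CohenMacaulay

universe u

variable {R : Type u} [CommRing R] [IsLocalRing R] [IsNoetherianRing R]

open IsLocalRing RingTheory.Sequence Pointwise

/-- Let N be the nonzero submodule killed by p. As x is regular, x y ∈ N forces y ∈ N, so if N
mapped to zero in M/xM, then N = xN, against Nakayama. Any associated prime of the image of N
contains both p and x, which annihilate it. -/
theorem exists_mem_associatedPrimes_quotSMulTop {M : Type*} [AddCommGroup M] [Module R M]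
    [Module.Finite R M] {x : R} (hx : x ∈ maximalIdeal R) (hreg : IsSMulRegular M x) {p : Ideal R}
    (hp : p ∈ associatedPrimes R M) :
    x ∉ p ∧ ∃ q ∈ associatedPrimes R (QuotSMulTop x M), p ≤ q ∧ x ∈ q := by
  obtain ⟨hpp, m, hm⟩ := isAssociatedPrime_iff.mp hp
  have hpm : ∀ r, r ∈ p ↔ r • m = 0 := by
    intro r
    rw [hm, Submodule.mem_colon_singleton, Submodule.mem_bot]
  have hm0 : m ≠ 0 := fun h => hpp.ne_top ((Ideal.eq_top_iff_one p).mpr ((hpm 1).mpr (by simp [h])))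
  refine ⟨fun hxp => hm0 (hreg (by simpa using (hpm x).mp hxp)), ?_⟩
  set N := Submodule.torsionBySet R M (p : Set R) with hN
  have hmemN : ∀ z, z ∈ N ↔ ∀ r ∈ p, r • z = 0 := by
    intro z
    rw [hN, Submodule.mem_torsionBySet_iff]
    exact ⟨fun h r hr => h ⟨r, hr⟩, fun h r => h r r.2⟩
  set Q := N.map (Submodule.mkQ (x • (⊤ : Submodule R M))) with hQ
  have hQ0 : Nontrivial Q := by
    rw [Submodule.nontrivial_iff_ne_bot]
    intro hbot
    have hle : N ≤ Ideal.span {x} • N := by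
      intro z hz
      have : (Submodule.mkQ (x • (⊤ : Submodule R M))) z ∈ Q := ⟨z, hz, rfl⟩
      rw [hbot, Submodule.mem_bot, Submodule.mkQ_apply, Submodule.Quotient.mk_eq_zero] at this
      obtain ⟨y, -, rfl⟩ := this
      refine Submodule.smul_mem_smul (Ideal.mem_span_singleton_self x) ((hmemN y).mpr fun r hr => ?_)
      have h1 := (hmemN _).mp hz r hr
      apply hreg
      simp only [DistribSMul.toLinearMap_apply, smul_zero] at h1 ⊢
      rw [smul_comm]
      exact h1
    have := Submodule.eq_bot_of_le_smul_of_le_jacobson_bot (Ideal.span {x}) N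
      (IsNoetherian.noetherian N) hle (by
        rw [Ideal.span_singleton_le_iff_mem, IsLocalRing.jacobson_eq_maximalIdeal _ bot_ne_top]
        exact hx)
    exact hm0 ((Submodule.mem_bot R).mp (this ▸ (hmemN m).mpr fun r hr => (hpm r).mp hr))
  obtain ⟨q, hq⟩ := associatedPrimes.nonempty R Q
  have hann : ∀ r : R, (∀ z : Q, r • z = 0) → r ∈ q := fun r hr =>
    hq.annihilator_le (by rw [Submodule.annihilator_top, Module.mem_annihilator]; exact hr)
  refine ⟨q, associatedPrimes.subset_of_injective (Submodule.subtype_injective Q) hq, ?_, ?_⟩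
  · refine fun r hr => hann r ?_
    rintro ⟨_, z, hz, rfl⟩
    ext
    rw [SetLike.val_smul, ← map_smul, (hmemN z).mp hz r hr, map_zero, ZeroMemClass.coe_zero]
  · refine hann x ?_
    rintro ⟨_, z, hz, rfl⟩
    ext
    rw [SetLike.val_smul, ← map_smul, ZeroMemClass.coe_zero, Submodule.mkQ_apply,
      Submodule.Quotient.mk_eq_zero]
    exact Submodule.smul_mem_pointwise_smul _ _ _ trivial

/-- Each regular element x leads from p to an associated prime q ⊇ p of M/xM with x ∈ q \ p, so dim
R/q is strictly smaller than dim R/p. -/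
theorem length_le_ringKrullDim_of_mem_associatedPrimes (rs : List R) {M : Type*} [AddCommGroup M]
    [Module R M] [Module.Finite R M] (hmem : ∀ r ∈ rs, r ∈ maximalIdeal R)
    (hreg : IsWeaklyRegular M rs) {p : Ideal R} (hp : p ∈ associatedPrimes R M) :
    ((rs.length : ℕ) : WithBot ℕ∞) ≤ ringKrullDim (R ⧸ p) := by
  induction rs generalizing M p with
  | nil =>
    have := hp.isPrime
    simpa using ringKrullDim_nonneg_of_nontrivial
  | cons x rs ih =>
    obtain ⟨h1, h2⟩ := (isWeaklyRegular_cons_iff M x rs).mp hreg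
    obtain ⟨hxp, q, hq, hpq, hxq⟩ :=
      exists_mem_associatedPrimes_quotSMulTop (hmem x (by simp)) h1 hp
    have := hp.isPrime
    have h3 := ih (fun r hr => hmem r (by simp [hr])) h2 hq
    have h4 : ringKrullDim (R ⧸ q) + 1 ≤ ringKrullDim (R ⧸ p) := by
      refine ringKrullDim_succ_le_of_surjective (Ideal.Quotient.factor hpq)
        (Ideal.Quotient.factor_surjective hpq) (r := Ideal.Quotient.mk p x)
        (mem_nonZeroDivisors_of_ne_zero fun h => hxp (Ideal.Quotient.eq_zero_iff_mem.mp h)) ?_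
      rw [Ideal.Quotient.factor_mk]
      exact Ideal.Quotient.eq_zero_iff_mem.mpr hxq
    refine le_trans ?_ h4
    rw [List.length_cons]
    push_cast
    gcongr

/-- Krull's height theorem in R/p: the hypothesis makes the maximal ideal minimal over the images of
`rs`. -/
theorem ringKrullDim_quotient_le_length (rs : List R) {p : Ideal R} [hp : p.IsPrime]
    (hmem : ∀ r ∈ rs, r ∈ maximalIdeal R)
    (h : ∀ P : Ideal R, P.IsPrime → p ≤ P → (∀ r ∈ rs, r ∈ P) → P = maximalIdeal R) :
    ringKrullDim (R ⧸ p) ≤ ((rs.length : ℕ) : WithBot ℕ∞) := by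
  classical
  have : Nontrivial (R ⧸ p) := Ideal.Quotient.nontrivial_iff.mpr hp.ne_top
  have : IsLocalRing (R ⧸ p) :=
    IsLocalRing.of_surjective' (Ideal.Quotient.mk p) Ideal.Quotient.mk_surjective
  set s := (rs.map (Ideal.Quotient.mk p)).toFinset with hs
  have hcard : s.card ≤ rs.length := by
    simpa using List.toFinset_card_le (rs.map (Ideal.Quotient.mk p))
  have hcomap : (maximalIdeal (R ⧸ p)).comap (Ideal.Quotient.mk p) = maximalIdeal R := by
    have := Ideal.comap_isMaximal_of_surjective (Ideal.Quotient.mk p)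
      Ideal.Quotient.mk_surjective (K := maximalIdeal (R ⧸ p))
    exact IsLocalRing.eq_maximalIdeal this
  have hmin : maximalIdeal (R ⧸ p) ∈ (Ideal.span (s : Set (R ⧸ p))).minimalPrimes := by
    refine ⟨⟨(maximalIdeal.isMaximal _).isPrime, ?_⟩, ?_⟩
    · rw [Ideal.span_le]
      intro z hz
      obtain ⟨r, hr, rfl⟩ : ∃ r ∈ rs, Ideal.Quotient.mk p r = z := by simpa [hs] using hz
      rw [SetLike.mem_coe, ← Ideal.mem_comap, hcomap]
      exact hmem r hr
    · rintro P ⟨hP, hsP⟩ -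
      have := h (P.comap (Ideal.Quotient.mk p)) (hP.comap _)
        (fun r hr => by
          rw [Ideal.mem_comap, Ideal.Quotient.eq_zero_iff_mem.mpr hr]
          exact P.zero_mem)
        (fun r hr => hsP (Ideal.subset_span (by simpa [hs] using ⟨r, hr, rfl⟩)))
      rw [← hcomap] at this
      exact (Ideal.comap_injective_of_surjective _ Ideal.Quotient.mk_surjective this).ge
  have := Ideal.height_le_card_of_mem_minimalPrimes_span_finset hmin
  rw [← IsLocalRing.maximalIdeal_height_eq_ringKrullDim]
  exact_mod_cast this.trans (by exact_mod_cast hcard)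

open CategoryTheory Abelian Limits in
-- Regular sequences of a given length are detected by vanishing of Ext groups. The long exact
-- sequence of 0 → M → M → M/xM → 0 costs one degree, whichever regular x is chosen.
theorem exists_isRegular_quotSMulTop {M : Type u} [AddCommGroup M] [Module R M]
    [Module.Finite R M] {n : ℕ} (h : ∃ rs : List R, rs.length = n + 1 ∧
      (∀ r ∈ rs, r ∈ maximalIdeal R) ∧ IsRegular M rs)
    {x : R} (hx : x ∈ maximalIdeal R) (hreg : IsSMulRegular M x) :
    ∃ rs : List R, rs.length = n ∧ (∀ r ∈ rs, r ∈ maximalIdeal R) ∧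
      IsRegular (QuotSMulTop x M) rs := by
  have : Nontrivial M := by
    obtain ⟨rs, -, -, hrs⟩ := h
    exact hrs.nontrivial
  have hlt : ∀ (L : Type u) [AddCommGroup L] [Module R L] [Module.Finite R L] [Nontrivial L],
      maximalIdeal R • (⊤ : Submodule R L) < ⊤ := fun L _ _ _ _ =>
    lt_top_iff_ne_top.mpr (Submodule.top_ne_ideal_smul_of_le_jacobson_annihilator
      (maximalIdeal_le_jacobson _)).symm
  have hnt : Nontrivial (QuotSMulTop x M) := nontrivial_quotSMulTop_of_mem_maximalIdeal M hx
  have hM := ((ModuleCat.exists_isRegular_tfae (maximalIdeal R) (n + 1) (ModuleCat.of R M)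
    (hlt M)).out 1 3).mpr h
  refine ((ModuleCat.exists_isRegular_tfae (maximalIdeal R) n (ModuleCat.of R (QuotSMulTop x M))
    (hlt _)).out 1 3).mp fun i hi => ?_
  have zero1 := AddCommGrpCat.isZero_of_iff_subsingleton.mpr (hM i (by omega))
  have zero2 := AddCommGrpCat.isZero_of_iff_subsingleton.mpr (hM (i + 1) (by omega))
  exact AddCommGrpCat.subsingleton_of_isZero <| ShortComplex.Exact.isZero_of_both_zeros
    ((Ext.covariant_sequence_exact₃' _
      (IsSMulRegular.smulShortComplex_shortExact (M := ModuleCat.of R M) hreg)) i (i + 1) rfl)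
    (zero1.eq_zero_of_src _) (zero2.eq_zero_of_tgt _)

/-- If the first parameter x were a zero divisor, it would lie in an associated prime p. The
remaining parameters would then bound dim R/p by one less than the depth, which is itself at most
dim R/p. So x is regular, and M/xM inherits the hypotheses. -/
theorem isWeaklyRegular_of_parameters (rs : List R) {M : Type u} [AddCommGroup M] [Module R M]
    [Module.Finite R M] (hmem : ∀ r ∈ rs, r ∈ maximalIdeal R)
    (hdepth : ∃ ss : List R, ss.length = rs.length ∧ (∀ r ∈ ss, r ∈ maximalIdeal R) ∧
      IsRegular M ss)
    (h : ∀ P : Ideal R, P.IsPrime → Module.annihilator R M ≤ P → (∀ r ∈ rs, r ∈ P) →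
      P = maximalIdeal R) : IsWeaklyRegular M rs := by
  induction rs generalizing M with
  | nil => exact IsWeaklyRegular.nil R M
  | cons x rs ih =>
    have hmem' : ∀ r ∈ rs, r ∈ maximalIdeal R := fun r hr => hmem r (by simp [hr])
    have hx : IsSMulRegular M x := by
      by_contra hx
      obtain ⟨p, hp, hxp⟩ : ∃ p ∈ associatedPrimes R M, x ∈ p := by
        have : x ∈ ⋃ p ∈ associatedPrimes R M, (p : Set R) := by
          rw [biUnion_associatedPrimes_eq_compl_regular]
          exact hx
        simpa using this
      have := hp.isPrime
      obtain ⟨ss, hss, hss', hss''⟩ := hdepth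
      have h1 := length_le_ringKrullDim_of_mem_associatedPrimes ss hss' hss''.toIsWeaklyRegular hp
      have h2 := ringKrullDim_quotient_le_length rs (p := p) hmem' fun P hP hpP hrP =>
        h P hP ((Submodule.annihilator_top (R := R) (M := M) ▸ hp.annihilator_le).trans hpP)
          (by simpa using ⟨hpP hxp, hrP⟩)
      have h3 := h1.trans h2
      rw [hss, List.length_cons] at h3
      have : rs.length + 1 ≤ rs.length := by exact_mod_cast h3
      omega
    refine (isWeaklyRegular_cons_iff M x rs).mpr ⟨hx, ih hmem' ?_ fun P hP hann hrP => ?_⟩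
    · exact exists_isRegular_quotSMulTop hdepth (hmem x (by simp)) hx
    · refine h P hP (le_trans (fun r hr => ?_) hann) ?_
      · rw [Module.mem_annihilator] at hr ⊢
        intro z
        obtain ⟨z, rfl⟩ := Submodule.mkQ_surjective _ z
        rw [← map_smul, hr, map_zero]
      · simp only [List.mem_cons, forall_eq_or_imp]
        refine ⟨hann ?_, hrP⟩
        rw [Module.mem_annihilator]
        intro z
        obtain ⟨z, rfl⟩ := Submodule.mkQ_surjective _ z
        rw [← map_smul, Submodule.mkQ_apply, Submodule.Quotient.mk_eq_zero]
        exact Submodule.smul_mem_pointwise_smul _ _ _ trivial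

end CohenMacaulay

/-! ### Powers of an ideal generated by a regular sequence -/

section Powers

variable {R : Type*} [CommRing R]

open RingTheory.Sequence Pointwise

theorem isWeaklyRegular_quotient_cons_iff (B : Ideal R) (x : R) (rs : List R) :
    IsWeaklyRegular (R ⧸ B) (x :: rs) ↔
      (∀ r, x * r ∈ B → r ∈ B) ∧ IsWeaklyRegular (R ⧸ (B ⊔ Ideal.span {x})) rs := by
  rw [isWeaklyRegular_cons_iff]
  refine and_congr ?_ ?_
  · rw [isSMulRegular_quotient_iff_mem_of_smul_mem]
    rfl
  · refine LinearEquiv.isWeaklyRegular_congr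
      ((Submodule.quotEquivOfEq _ _ ?_).trans (Submodule.quotientQuotientEquivQuotientSup B _)) rs
    rw [Submodule.map_span, Set.image_singleton]
    ext z
    obtain ⟨z, rfl⟩ := Submodule.mkQ_surjective _ z
    rw [Submodule.mem_span_singleton]
    constructor
    · rintro ⟨w, -, hw⟩
      obtain ⟨w, rfl⟩ := Submodule.mkQ_surjective _ w
      exact ⟨w, by
        rw [← hw, ← map_smul, DistribSMul.toLinearMap_apply, ← map_smul, smul_eq_mul, smul_eq_mul,
          mul_comm]⟩
    · rintro ⟨w, hw⟩
      refine ⟨Submodule.mkQ B w, trivial, ?_⟩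
      rw [← hw, ← map_smul, DistribSMul.toLinearMap_apply, ← map_smul, smul_eq_mul, smul_eq_mul,
          mul_comm]

theorem sup_pow_succ_eq (A C : Ideal R) (n : ℕ) :
    (A ⊔ C) ^ (n + 1) = A * (A ⊔ C) ^ n ⊔ C ^ (n + 1) := by
  induction n with
  | zero => simp
  | succ n ih =>
    rw [pow_succ' (A ⊔ C) (n + 1), Ideal.sup_mul]
    refine le_antisymm (sup_le le_sup_left ?_) (sup_le le_sup_left ?_)
    · nth_rewrite 1 [ih]
      rw [Ideal.mul_sup]
      refine sup_le_sup ?_ (by rw [← pow_succ'])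
      rw [mul_left_comm]
      refine Ideal.mul_mono_right ?_
      rw [pow_succ']
      exact Ideal.mul_mono_left le_sup_right
    · refine le_sup_of_le_right ?_
      rw [pow_succ' C]
      exact Ideal.mul_mono_right (Ideal.pow_right_mono le_sup_right _)

theorem length_quotient_eq_add_of_colon {N N' : Ideal R} {y : R} (h : ∀ r, y * r ∈ N ↔ r ∈ N') :
    Module.length R (R ⧸ N) =
      Module.length R (R ⧸ N') + Module.length R (R ⧸ (N ⊔ Ideal.span {y})) := by
  refine Module.length_eq_add_of_exact
    (Submodule.mapQ N' N (LinearMap.lsmul R R y)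
      (Submodule.map_le_iff_le_comap.mp (by rintro _ ⟨r, hr, rfl⟩; exact (h r).mpr hr)))
    (Submodule.factor (le_sup_left : N ≤ N ⊔ Ideal.span {y})) ?_ (Submodule.factor_surjective _) ?_
  · rw [injective_iff_map_eq_zero]
    intro r hr
    obtain ⟨r, rfl⟩ := Submodule.mkQ_surjective _ r
    rw [Submodule.mkQ_apply, Submodule.mapQ_apply, Submodule.Quotient.mk_eq_zero] at hr
    rw [Submodule.mkQ_apply, Submodule.Quotient.mk_eq_zero]
    exact (h r).mp hr
  · intro z
    obtain ⟨z, rfl⟩ := Submodule.mkQ_surjective _ z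
    rw [Submodule.mkQ_apply, Submodule.factor, Submodule.mapQ_apply, LinearMap.id_apply,
      Submodule.Quotient.mk_eq_zero, Submodule.mem_sup]
    constructor
    · rintro ⟨u, hu, w, hw, rfl⟩
      obtain ⟨t, rfl⟩ := Ideal.mem_span_singleton'.mp hw
      refine ⟨Submodule.Quotient.mk t, ?_⟩
      rw [Submodule.mapQ_apply, Submodule.Quotient.eq]
      convert N.neg_mem hu using 1
      simp only [LinearMap.lsmul_apply, smul_eq_mul]
      ring
    · rintro ⟨t, ht⟩
      obtain ⟨t, rfl⟩ := Submodule.mkQ_surjective _ t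
      rw [Submodule.mkQ_apply, Submodule.mapQ_apply, Submodule.Quotient.eq] at ht
      refine ⟨-(y * t - z), N.neg_mem ht, y * t, ?_, by ring⟩
      exact Ideal.mul_mem_right _ _ (Ideal.mem_span_singleton_self y)

variable [IsLocalRing R] [IsNoetherianRing R]

open IsLocalRing

/-- Write y r = y s + w with s ∈ (y, rs)^n and w ∈ (rs)^(n+1) + B; then y cancels from y (r - s)
modulo (rs)^(n+1) + B, by `hx` after moving y to the end. The hypothesis `hx` is the inductive
hypothesis of `mem_pow_sup_of_mul_mem`. -/
theorem mem_pow_sup_of_cons_mul_mem_aux {rs : List R} (hmem : ∀ r ∈ rs, r ∈ maximalIdeal R)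
    (hx : ∀ (B : Ideal R) (x : R), x ∈ maximalIdeal R → IsWeaklyRegular (R ⧸ B) (rs ++ [x]) →
      ∀ n r, x * r ∈ Ideal.ofList rs ^ n ⊔ B → r ∈ Ideal.ofList rs ^ n ⊔ B)
    {B : Ideal R} {y : R} (hy : y ∈ maximalIdeal R) (hreg : IsWeaklyRegular (R ⧸ B) (y :: rs))
    {n : ℕ} {r : R} (hr : y * r ∈ Ideal.ofList (y :: rs) ^ (n + 1) ⊔ B) :
    r ∈ Ideal.ofList (y :: rs) ^ n ⊔ B := by
  rw [Ideal.ofList_cons, sup_pow_succ_eq, sup_assoc, Submodule.mem_sup] at hr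
  obtain ⟨u, hu, w, hw, huw⟩ := hr
  obtain ⟨s, hs, rfl⟩ := Ideal.mem_span_singleton_mul.mp hu
  have hw' : y * (r - s) ∈ Ideal.ofList rs ^ (n + 1) ⊔ B := by
    rw [mul_sub, ← huw, add_sub_cancel_left]
    exact hw
  have hreg' : IsWeaklyRegular (R ⧸ B) (rs ++ [y]) :=
    IsLocalRing.isWeaklyRegular_of_perm_of_subset_maximalIdeal hreg
      (List.perm_append_singleton y rs).symm (by simpa using ⟨hy, hmem⟩)
  have := hx B y hy hreg' (n + 1) (r - s) hw'
  rw [Ideal.ofList_cons, ← sub_add_cancel r s]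
  refine Ideal.add_mem _ (sup_le_sup_right ?_ B this) (Ideal.mem_sup_left hs)
  exact (Ideal.pow_le_pow_right n.le_succ).trans (Ideal.pow_right_mono le_sup_right _)

/-- Double induction, on the sequence and on n. Modulo y the shorter sequence gives r = s + t y with
s harmless; cancelling y leaves x t in the power lower by one, so t lies there by induction on n and
t y is back in the original power. -/
theorem mem_pow_sup_of_mul_mem {rs : List R} (hmem : ∀ r ∈ rs, r ∈ maximalIdeal R)
    {B : Ideal R} {x : R} (hx : x ∈ maximalIdeal R)
    (hreg : IsWeaklyRegular (R ⧸ B) (rs ++ [x])) {n : ℕ} {r : R}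
    (hr : x * r ∈ Ideal.ofList rs ^ n ⊔ B) : r ∈ Ideal.ofList rs ^ n ⊔ B := by
  induction rs generalizing B x n r with
  | nil =>
    rw [List.nil_append, isWeaklyRegular_quotient_cons_iff] at hreg
    cases n with
    | zero => simp
    | succ n =>
      have hz : (Ideal.ofList ([] : List R)) ^ (n + 1) ⊔ B = B := by
        rw [Ideal.ofList_nil, pow_succ, Ideal.mul_bot, bot_sup_eq]
      rw [hz] at hr ⊢
      exact hreg.1 r hr
  | cons y rs ih =>
    have hmem' : ∀ r ∈ rs, r ∈ maximalIdeal R := fun r hr => hmem r (by simp [hr])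
    have hy : y ∈ maximalIdeal R := hmem y (by simp)
    have hreg1 : IsWeaklyRegular (R ⧸ B) (y :: rs) :=
      ((isWeaklyRegular_append_iff _ (y :: rs) [x]).mp hreg).1
    rw [List.cons_append, isWeaklyRegular_quotient_cons_iff] at hreg
    induction n generalizing r with
    | zero => simp
    | succ n ihn =>
      have h1 : x * r ∈ Ideal.ofList rs ^ (n + 1) ⊔ (B ⊔ Ideal.span {y}) := by
        refine (sup_le ?_ (le_sup_of_le_right le_sup_left) :
          Ideal.ofList (y :: rs) ^ (n + 1) ⊔ B ≤ _) hr
        rw [Ideal.ofList_cons, sup_pow_succ_eq]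
        exact sup_le (le_sup_of_le_right (le_sup_of_le_right Ideal.mul_le_left)) le_sup_left
      have h2 := ih hmem' hx hreg.2 h1
      rw [← sup_assoc, Submodule.mem_sup] at h2
      obtain ⟨s, hs, w, hw, rfl⟩ := h2
      obtain ⟨t, rfl⟩ := Ideal.mem_span_singleton'.mp hw
      have hs' : s ∈ Ideal.ofList (y :: rs) ^ (n + 1) ⊔ B := by
        refine sup_le_sup_right (Ideal.pow_right_mono ?_ _) B hs
        rw [Ideal.ofList_cons]
        exact le_sup_right
      have h3 : y * (x * t) ∈ Ideal.ofList (y :: rs) ^ (n + 1) ⊔ B := by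
        have := Ideal.sub_mem _ hr (Ideal.mul_mem_left _ x hs')
        rwa [mul_add, add_sub_cancel_left, show x * (t * y) = y * (x * t) by ring] at this
      have h4 := ihn (mem_pow_sup_of_cons_mul_mem_aux hmem'
        (fun B y hy hreg n r => ih hmem' hy hreg) hy hreg1 h3)
      refine Ideal.add_mem _ hs' ?_
      obtain ⟨p, hp, b, hb, rfl⟩ := Submodule.mem_sup.mp h4
      rw [add_mul]
      refine Ideal.add_mem _ (Ideal.mem_sup_left ?_)
        (Ideal.mem_sup_right (Ideal.mul_mem_right _ _ hb))
      rw [pow_succ]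
      refine Ideal.mul_mem_mul hp ?_
      rw [Ideal.ofList_cons]
      exact Ideal.mem_sup_left (Ideal.mem_span_singleton_self y)

theorem mem_pow_sup_of_cons_mul_mem {rs : List R} (hmem : ∀ r ∈ rs, r ∈ maximalIdeal R)
    {B : Ideal R} {y : R} (hy : y ∈ maximalIdeal R) (hreg : IsWeaklyRegular (R ⧸ B) (y :: rs))
    {n : ℕ} {r : R} (hr : y * r ∈ Ideal.ofList (y :: rs) ^ (n + 1) ⊔ B) :
    r ∈ Ideal.ofList (y :: rs) ^ n ⊔ B :=
  mem_pow_sup_of_cons_mul_mem_aux hmem (fun _ _ hx hreg _ _ => mem_pow_sup_of_mul_mem hmem hx hreg)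
    hy hreg hr

/-- The Hilbert-Samuel function of an ideal generated by a regular sequence. -/
theorem length_quotient_pow_sup {rs : List R} (hmem : ∀ r ∈ rs, r ∈ maximalIdeal R)
    {B : Ideal R} (hreg : IsWeaklyRegular (R ⧸ B) rs) (n : ℕ) :
    Module.length R (R ⧸ (Ideal.ofList rs ^ (n + 1) ⊔ B)) =
      Module.length R (R ⧸ (Ideal.ofList rs ⊔ B)) * ((n + rs.length).choose rs.length : ℕ) := by
  induction rs generalizing B n with
  | nil =>
    have hz : (Ideal.ofList ([] : List R)) ^ (n + 1) ⊔ B = Ideal.ofList ([] : List R) ⊔ B := by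
      rw [Ideal.ofList_nil, pow_succ, Ideal.mul_bot]
    rw [hz]
    simp
  | cons y rs ih =>
    have hmem' : ∀ r ∈ rs, r ∈ maximalIdeal R := fun r hr => hmem r (by simp [hr])
    have hy : y ∈ maximalIdeal R := hmem y (by simp)
    have hreg' := ((isWeaklyRegular_quotient_cons_iff B y rs).mp hreg).2
    have hJ : Ideal.ofList rs ⊔ (B ⊔ Ideal.span {y}) = Ideal.ofList (y :: rs) ⊔ B := by
      rw [Ideal.ofList_cons]
      ac_rfl
    induction n with
    | zero => rw [zero_add, zero_add, pow_one, Nat.choose_self, Nat.cast_one, mul_one]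
    | succ n ihn =>
      have hyJ : y ∈ Ideal.ofList (y :: rs) := by
        rw [Ideal.ofList_cons]
        exact Ideal.mem_sup_left (Ideal.mem_span_singleton_self y)
      -- Multiplication by y lowers the power by one, and killing y shortens the sequence; the two
      -- lengths add up by Pascal's rule.
      rw [length_quotient_eq_add_of_colon (y := y) (N' := Ideal.ofList (y :: rs) ^ (n + 1) ⊔ B)
        fun r => ⟨mem_pow_sup_of_cons_mul_mem hmem' hy hreg, fun hr => ?_⟩]
      · have h1 : Ideal.ofList (y :: rs) ^ (n + 1 + 1) ⊔ B ⊔ Ideal.span {y} =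
            Ideal.ofList rs ^ (n + 1 + 1) ⊔ (B ⊔ Ideal.span {y}) := by
          rw [← sup_assoc]
          refine le_antisymm (sup_le (sup_le ?_ (le_sup_of_le_left le_sup_right)) le_sup_right)
            (sup_le_sup_right (sup_le_sup_right (Ideal.pow_right_mono ?_ _) _) _)
          · rw [Ideal.ofList_cons, sup_pow_succ_eq]
            exact sup_le (le_sup_of_le_right Ideal.mul_le_left)
              (le_sup_of_le_left le_sup_left)
          · rw [Ideal.ofList_cons]
            exact le_sup_right
        rw [h1, ih hmem' hreg', ihn, hJ, ← mul_add, ← Nat.cast_add, List.length_cons]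
        congr 2
        rw [show n + 1 + (rs.length + 1) = (n + 1 + rs.length) + 1 by ring,
          Nat.choose_succ_succ, show n + (rs.length + 1) = n + 1 + rs.length by ring, add_comm]
      · obtain ⟨p, hp, b, hb, rfl⟩ := Submodule.mem_sup.mp hr
        rw [mul_add]
        refine Ideal.add_mem _ (Ideal.mem_sup_left ?_)
          (Ideal.mem_sup_right (Ideal.mul_mem_left _ _ hb))
        rw [pow_succ']
        exact Ideal.mul_mem_mul hyJ hp

end Powers

/-! ### Lengths of subquotients -/

section Lengths

variable {R : Type*} [CommRing R]

theorem quotLength_add_length {L N : Ideal R} (h : N ≤ L) :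
    quotLength L N + Module.length R (R ⧸ L) = Module.length R (R ⧸ N) := by
  refine (Module.length_eq_add_of_exact
    (Submodule.mapQ (Submodule.comap L.subtype N) N L.subtype le_rfl)
    (Submodule.factor h) ?_ (Submodule.factor_surjective _) ?_).symm
  · rw [injective_iff_map_eq_zero]
    intro z hz
    obtain ⟨z, rfl⟩ := Submodule.mkQ_surjective _ z
    rw [Submodule.mkQ_apply, Submodule.mapQ_apply, Submodule.Quotient.mk_eq_zero] at hz
    rw [Submodule.mkQ_apply, Submodule.Quotient.mk_eq_zero]
    exact hz
  · intro z
    obtain ⟨z, rfl⟩ := Submodule.mkQ_surjective _ z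
    rw [Submodule.mkQ_apply, Submodule.factor, Submodule.mapQ_apply, LinearMap.id_apply,
      Submodule.Quotient.mk_eq_zero]
    constructor
    · exact fun hz => ⟨Submodule.Quotient.mk ⟨z, hz⟩, rfl⟩
    · rintro ⟨t, ht⟩
      obtain ⟨t, rfl⟩ := Submodule.mkQ_surjective _ t
      rw [Submodule.mkQ_apply, Submodule.mapQ_apply, Submodule.Quotient.eq] at ht
      have := L.sub_mem t.2 (h ht)
      simpa using this

/-- The length of `R / N`, as an integer. -/
def colength (N : Ideal R) : ℤ := ((Module.length R (R ⧸ N)).toNat : ℤ)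

theorem quotLength_ne_top {L N : Ideal R} (h : N ≤ L) (hN : Module.length R (R ⧸ N) ≠ ⊤) :
    quotLength L N ≠ ⊤ :=
  ne_top_of_le_ne_top hN (quotLength_add_length h ▸ le_self_add)

theorem quotLength_toNat {L N : Ideal R} (h : N ≤ L) (hN : Module.length R (R ⧸ N) ≠ ⊤) :
    ((quotLength L N).toNat : ℤ) = colength N - colength L := by
  have h1 := quotLength_add_length h
  have h2 := hN
  rw [← h1, Ne, ENat.add_eq_top, not_or] at h2
  rw [colength, colength, ← h1, ENat.toNat_add h2.1 h2.2]
  push_cast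
  ring

theorem quotLength_self (L : Ideal R) : quotLength L L = 0 := by
  rw [quotLength, Module.length_eq_zero_iff, Submodule.Quotient.subsingleton_iff,
    Submodule.comap_subtype_self]

theorem quotLength_sup_le (U U' V V' : Ideal R) :
    quotLength (U ⊔ V) (U' ⊔ V') ≤ quotLength U U' + quotLength V V' := by
  unfold quotLength
  rw [← Module.length_prod]
  refine Module.length_le_of_surjective (LinearMap.coprod
    (Submodule.mapQ (Submodule.comap U.subtype U')
      (Submodule.comap (U ⊔ V).subtype (U' ⊔ V')) (Submodule.inclusion le_sup_left)
      fun z hz => Ideal.mem_sup_left (show (z : R) ∈ U' from hz))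
    (Submodule.mapQ (Submodule.comap V.subtype V')
      (Submodule.comap (U ⊔ V).subtype (U' ⊔ V')) (Submodule.inclusion le_sup_right)
      fun z hz => Ideal.mem_sup_right (show (z : R) ∈ V' from hz))) ?_
  intro z
  obtain ⟨⟨z, hz⟩, rfl⟩ := Submodule.mkQ_surjective _ z
  obtain ⟨u, hu, v, hv, rfl⟩ := Submodule.mem_sup.mp hz
  refine ⟨(Submodule.Quotient.mk ⟨u, hu⟩, Submodule.Quotient.mk ⟨v, hv⟩), ?_⟩
  rw [LinearMap.coprod_apply, Submodule.mapQ_apply, Submodule.mapQ_apply,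
    ← Submodule.Quotient.mk_add]
  rfl

theorem quotLength_singleton_mul_le (y : R) (U U' : Ideal R) :
    quotLength (Ideal.span {y} * U) (Ideal.span {y} * U') ≤ quotLength U U' := by
  have hy : ∀ (W : Ideal R), ∀ w ∈ W, y * w ∈ Ideal.span {y} * W := fun W w hw =>
    Ideal.mul_mem_mul (Ideal.mem_span_singleton_self y) hw
  refine Module.length_le_of_surjective (Submodule.mapQ (Submodule.comap U.subtype U')
    (Submodule.comap (Ideal.span {y} * U).subtype (Ideal.span {y} * U'))
    ((LinearMap.lsmul R R y).restrict (hy U)) fun z hz => hy U' z hz) ?_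
  intro z
  obtain ⟨⟨z, hz⟩, rfl⟩ := Submodule.mkQ_surjective _ z
  obtain ⟨u, hu, rfl⟩ := Ideal.mem_span_singleton_mul.mp hz
  exact ⟨Submodule.Quotient.mk ⟨u, hu⟩, rfl⟩

/-- The n-th power is generated by the monomials of degree n, each contributing at most λ(R/Q). No
regularity is needed for this upper bound. -/
theorem quotLength_pow_le (rs : List R) (Q : Ideal R) (n : ℕ) :
    quotLength (Ideal.ofList rs ^ n) (Ideal.ofList rs ^ n * Q) ≤
      Module.length R (R ⧸ Q) * (Nat.multichoose rs.length n : ℕ) := by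
  have h0 : ∀ J : Ideal R, quotLength (J ^ 0) (J ^ 0 * Q) ≤ Module.length R (R ⧸ Q) := by
    intro J
    rw [pow_zero, Ideal.one_eq_top, Ideal.top_mul, ← quotLength_add_length (N := Q) le_top]
    exact le_self_add
  induction rs generalizing n with
  | nil =>
    cases n with
    | zero => simpa using h0 ⊥
    | succ n =>
      rw [Ideal.ofList_nil, pow_succ, Ideal.mul_bot, Ideal.bot_mul, quotLength_self]
      exact bot_le
  | cons y rs ih =>
    induction n with
    | zero => simpa using h0 (Ideal.ofList (y :: rs))
    | succ n ihn =>
      rw [Ideal.ofList_cons] at ihn ⊢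
      rw [sup_pow_succ_eq, Ideal.sup_mul, mul_assoc]
      refine (quotLength_sup_le _ _ _ _).trans ?_
      refine (add_le_add ((quotLength_singleton_mul_le _ _ _).trans ihn) (ih (n + 1))).trans ?_
      rw [← mul_add, ← Nat.cast_add, List.length_cons, Nat.multichoose_succ_succ, add_comm]

theorem quotLength_inf_eq (A B : Ideal R) : quotLength A (A ⊓ B) = quotLength (A ⊔ B) B :=
  (LinearMap.quotientInfEquivSupQuotient A B).length_eq

theorem length_quotient_ne_top [IsLocalRing R] [IsNoetherianRing R] {I N : Ideal R}
    (hI : I.radical = IsLocalRing.maximalIdeal R) {k : ℕ} (h : I ^ k ≤ N) :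
    Module.length R (R ⧸ N) ≠ ⊤ := by
  rcases eq_or_ne N ⊤ with rfl | hN
  · have : Subsingleton (R ⧸ (⊤ : Ideal R)) := Ideal.Quotient.subsingleton_iff.mpr rfl
    rw [Module.length_eq_zero]
    exact ENat.zero_ne_top
  have : Nontrivial (R ⧸ N) := Ideal.Quotient.nontrivial_iff.mpr hN
  have : IsLocalRing (R ⧸ N) :=
    IsLocalRing.of_surjective' (Ideal.Quotient.mk N) Ideal.Quotient.mk_surjective
  obtain ⟨l, hl⟩ := Ideal.exists_radical_pow_le_of_fg I (IsNoetherian.noetherian _)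
  have hart : IsArtinianRing (R ⧸ N) := by
    rw [isArtinianRing_iff_isNilpotent_maximalIdeal]
    refine ⟨l * k, ?_⟩
    have hmax : IsLocalRing.maximalIdeal (R ⧸ N) =
        (IsLocalRing.maximalIdeal R).map (Ideal.Quotient.mk N) := by
      rw [← Ideal.map_comap_of_surjective _ Ideal.Quotient.mk_surjective
        (IsLocalRing.maximalIdeal (R ⧸ N))]
      have := Ideal.comap_isMaximal_of_surjective (Ideal.Quotient.mk N)
        Ideal.Quotient.mk_surjective (K := IsLocalRing.maximalIdeal (R ⧸ N))
      rw [IsLocalRing.eq_maximalIdeal this]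
    rw [hmax, ← Ideal.map_pow, Ideal.zero_eq_bot, Ideal.map_eq_bot_iff_le_ker, Ideal.mk_ker,
      pow_mul, ← hI]
    exact (Ideal.pow_right_mono hl k).trans h
  rw [Module.length_eq_of_surjective (R := R ⧸ N) (S := R) (M := R ⧸ N)
    Ideal.Quotient.mk_surjective]
  exact Module.length_ne_top

end Lengths

/-! ### The bigraded pieces -/

section Pieces

variable {R : Type*} [CommRing R] (I J : Ideal R)

/-- The piece of degree `m` of the `j`-th power of the ideal `Jt R(I)`. -/
def reesPowPiece (j m : ℕ) : Ideal R := if j ≤ m then J ^ j * I ^ (m - j) else ⊥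

theorem pow_mul_reesPowPiece_le (j k m : ℕ) :
    I ^ k * reesPowPiece I J j m ≤ reesPowPiece I J j (k + m) := by
  unfold reesPowPiece
  split_ifs with h1 h2
  · rw [mul_left_comm, ← pow_add, Nat.add_sub_assoc h1]
  · omega
  · simp
  · simp

theorem reesPowPiece_mul_le (j m k : ℕ) :
    reesPowPiece I J j m * reesPowPiece I J 1 k ≤ reesPowPiece I J (j + 1) (m + k) := by
  unfold reesPowPiece
  split_ifs with h1 h2 h3 h4
  · refine le_of_eq ?_
    rw [mul_mul_mul_comm, ← pow_add, ← pow_add, show m - j + (k - 1) = m + k - (j + 1) by omega]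
  · omega
  all_goals simp

/-- This coefficientwise bound is what recovers c ∈ J^j I^i from c t^(i+j) ∈ (Jt R(I))^j. -/
theorem reesIdeal_pow_le (j : ℕ) :
    reesIdeal I J ^ j ≤ reesGradedIdeal I (reesPowPiece I J j) (pow_mul_reesPowPiece_le I J j) := by
  have h1 : reesIdeal I J ≤
      reesGradedIdeal I (reesPowPiece I J 1) (pow_mul_reesPowPiece_le I J 1) := by
    refine Ideal.span_le.mpr ?_
    rintro f ⟨b, hb, hf⟩ m
    rw [hf, coeff_monomial]
    split_ifs with h
    · subst h
      simpa [reesPowPiece] using hb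
    · exact Ideal.zero_mem _
  induction j with
  | zero =>
    intro f _ m
    simpa [reesPowPiece] using f.2 m
  | succ j ih =>
    rw [pow_succ, Ideal.mul_le]
    intro f hf g hg m
    rw [MulMemClass.coe_mul, coeff_mul]
    refine Ideal.sum_mem _ fun p hp => ?_
    rw [← Finset.HasAntidiagonal.mem_antidiagonal.mp hp]
    exact reesPowPiece_mul_le I J _ _ _ (Ideal.mul_mem_mul (ih hf p.1) (h1 hg p.2))

variable {I J}

theorem mem_pow_of_mem_pow_mul (hJI : J ≤ I) {i j : ℕ} {c : R} (hc : c ∈ J ^ j * I ^ i) :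
    c ∈ I ^ (i + j) := by
  rw [add_comm, pow_add]
  exact Ideal.mul_mono_left (Ideal.pow_right_mono hJI j) hc

theorem reesMonomial_mem_iff (hJI : J ≤ I) {i j : ℕ} {c : R} (hc : c ∈ I ^ (i + j)) :
    reesMonomial I (i + j) c hc ∈ reesIdeal I J ^ j ↔ c ∈ J ^ j * I ^ i := by
  constructor
  · intro h
    simpa [reesMonomial, reesPowPiece] using reesIdeal_pow_le I J j h (i + j)
  · intro h
    suffices ∀ c ∈ J ^ j * I ^ i, ∃ f ∈ reesIdeal I J ^ j, (f : R[X]) = monomial (i + j) c by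
      obtain ⟨f, hf, hfc⟩ := this c h
      convert hf
      exact Subtype.ext hfc.symm
    clear h hc c
    induction j with
    | zero =>
      intro c hc
      exact ⟨reesMonomial I i c (by simpa using hc), by simp, rfl⟩
    | succ j ih =>
      intro c hc
      rw [pow_succ', mul_assoc] at hc
      induction hc using Submodule.mul_induction_on' with
      | mem_mul_mem b hb c hc =>
        obtain ⟨f, hf, hfc⟩ := ih c hc
        refine ⟨reesMonomial I 1 b (by simpa using hJI hb) * f, ?_, ?_⟩
        · rw [pow_succ']
          exact Ideal.mul_mem_mul (Ideal.subset_span ⟨b, hb, rfl⟩) hf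
        · rw [MulMemClass.coe_mul, hfc, reesMonomial, monomial_mul_monomial,
            show 1 + (i + j) = i + (j + 1) by ring]
      | add x _ y _ hx hy =>
        obtain ⟨f, hf, hfc⟩ := hx
        obtain ⟨g, hg, hgc⟩ := hy
        exact ⟨f + g, Ideal.add_mem _ hf hg, by rw [AddMemClass.coe_add, hfc, hgc, map_add]⟩

theorem assocGr_of_eq_zero_iff {A : Type*} [CommRing A] (Q : Ideal A) (n : ℕ) (f : A)
    (hf : f ∈ Q ^ n) : AssocGr.of Q n f hf = 0 ↔ f ∈ Q ^ (n + 1) := by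
  have h0 : AssocGr.of Q n f hf = 0 ↔ (⟨monomial n f, reesAlgebra.monomial_mem.mpr hf⟩ :
      ↥(reesAlgebra Q)) ∈ Q.map (algebraMap A ↥(reesAlgebra Q)) := Ideal.Quotient.eq_zero_iff_mem
  rw [h0]
  constructor
  · intro h
    have hle : Q.map (algebraMap A ↥(reesAlgebra Q)) ≤
        reesGradedIdeal Q (fun n => Q ^ (n + 1)) fun k m => by rw [← pow_add, add_assoc] := by
      rw [Ideal.map_le_iff_le_comap]
      intro q hq m
      change (C q).coeff m ∈ _
      rw [coeff_C]
      split_ifs with hm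
      · simpa [hm] using hq
      · exact Ideal.zero_mem _
    simpa using hle h n
  · intro h
    suffices ∀ f ∈ Q * Q ^ n, ∃ F ∈ Q.map (algebraMap A ↥(reesAlgebra Q)),
        (F : A[X]) = monomial n f by
      obtain ⟨F, hF, hFf⟩ := this f (by rwa [← pow_succ'])
      convert hF
      exact hFf.symm
    intro f hf
    induction hf using Submodule.mul_induction_on' with
    | mem_mul_mem q hq g hg =>
      refine ⟨algebraMap A _ q * ⟨monomial n g, reesAlgebra.monomial_mem.mpr hg⟩,
        Ideal.mul_mem_right _ _ (Ideal.mem_map_of_mem _ hq), ?_⟩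
      rw [MulMemClass.coe_mul]
      exact C_mul_monomial
    | add x _ y _ hx hy =>
      obtain ⟨f, hf, hfc⟩ := hx
      obtain ⟨g, hg, hgc⟩ := hy
      exact ⟨f + g, Ideal.add_mem _ hf hg, by rw [AddMemClass.coe_add, hfc, hgc, map_add]⟩

theorem exists_reesMonomial_of_mem_reesPiece {m : ℕ} {f : ↥(reesAlgebra I)}
    (hf : f ∈ reesPiece I m) : ∃ (c : R) (hc : c ∈ I ^ m), f = reesMonomial I m c hc := by
  obtain ⟨c, hc⟩ := hf
  have hc' : (f : R[X]) = monomial m c := hc.symm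
  exact ⟨c, reesAlgebra.monomial_mem.mp (hc' ▸ f.2), Subtype.ext hc'⟩

/-- The map `c ↦ c t^(i + j) U^j` from `J^j I^i` to `gr_{Jt}(R(I))`. -/
def grMap (hJI : J ≤ I) (i j : ℕ) : ↥(J ^ j * I ^ i) →ₗ[R] GrRees I J where
  toFun c := AssocGr.of (reesIdeal I J) j
    (reesMonomial I (i + j) c (mem_pow_of_mem_pow_mul hJI c.2))
    ((reesMonomial_mem_iff hJI _).mpr c.2)
  map_add' x y := by
    unfold AssocGr.of
    rw [← map_add]
    congr 1
    refine Subtype.ext ?_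
    change monomial j _ = monomial j _ + monomial j _
    rw [← map_add]
    congr 1
    exact Subtype.ext (map_add _ _ _)
  map_smul' r x := by
    unfold AssocGr.of
    change AssocGr.mk (R := R) (reesIdeal I J) _ = r • AssocGr.mk (R := R) (reesIdeal I J) _
    rw [← map_smul]
    congr 1
    refine Subtype.ext ?_
    change monomial j _ = r • monomial j _
    rw [smul_monomial]
    congr 1
    exact Subtype.ext (smul_monomial _ _ _).symm

theorem range_grMap (hJI : J ≤ I) (i j : ℕ) :
    LinearMap.range (grMap hJI i j) = grPiece I J i j := by
  ext z
  constructor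
  · rintro ⟨c, rfl⟩
    exact ⟨_, (reesMonomial_mem_iff hJI _).mpr c.2, ⟨c, rfl⟩, rfl⟩
  · rintro ⟨f, hf, hf', rfl⟩
    obtain ⟨c, hc, rfl⟩ := exists_reesMonomial_of_mem_reesPiece hf'
    exact ⟨⟨c, (reesMonomial_mem_iff hJI hc).mp hf⟩, rfl⟩

/-- The class of c t^(p+1+n) U^n vanishes exactly when c t^(p+1+n) lies in (Jt R(I))^(n+1). Since
p+1+n = p+(n+1), this means c ∈ J^(n+1) I^p. -/
theorem sigmaHilb_eq (hJI : J ≤ I) (p n : ℕ) :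
    sigmaHilb I J p n = quotLength (J ^ n * I ^ (p + 1)) (J ^ (n + 1) * I ^ p) := by
  rw [sigmaHilb, ← range_grMap hJI, ← (grMap hJI (p + 1) n).quotKerEquivRange.length_eq, quotLength]
  refine (Submodule.quotEquivOfEq _ _ ?_).length_eq
  ext c
  rw [LinearMap.mem_ker, Submodule.mem_comap, Submodule.subtype_apply,
    ← reesMonomial_mem_iff hJI (i := p) (j := n + 1) (by
      rw [show p + (n + 1) = p + 1 + n by ring]
      exact mem_pow_of_mem_pow_mul hJI c.2)]
  refine (assocGr_of_eq_zero_iff _ _ _ ((reesMonomial_mem_iff hJI _).mpr c.2)).trans ?_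
  have h : p + 1 + n = p + (n + 1) := by ring
  congr! 1
  refine Subtype.ext ?_
  change monomial _ _ = monomial _ _
  rw [h]

/-- The map `c ↦ c t^i` from `I^i` to `R(I) / Jt R(I)`. -/
def fiberMap (I J : Ideal R) (i : ℕ) : ↥(I ^ i) →ₗ[R] FiberRing I J :=
  (FiberRing.mk I J).toLinearMap ∘ₗ
    { toFun := fun c => reesMonomial I i c c.2
      map_add' := fun _ _ => Subtype.ext (map_add _ _ _)
      map_smul' := fun _ _ => Subtype.ext (smul_monomial _ _ _).symm }

theorem fiberMap_apply (i : ℕ) (c : ↥(I ^ i)) :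
    fiberMap I J i c = FiberRing.mk I J (reesMonomial I i c c.2) := rfl

theorem range_fiberMap (i : ℕ) : LinearMap.range (fiberMap I J i) = fiberPiece I J i := by
  ext z
  constructor
  · rintro ⟨c, rfl⟩
    exact ⟨_, ⟨c, rfl⟩, rfl⟩
  · rintro ⟨f, hf, rfl⟩
    obtain ⟨c, hc, rfl⟩ := exists_reesMonomial_of_mem_reesPiece hf
    exact ⟨⟨c, hc⟩, rfl⟩

theorem length_fiberPiece (hJI : J ≤ I) (p : ℕ) :
    Module.length R ↥(fiberPiece I J (p + 1)) = quotLength (I ^ (p + 1)) (J * I ^ p) := by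
  rw [← range_fiberMap, ← (fiberMap I J (p + 1)).quotKerEquivRange.length_eq, quotLength]
  refine (Submodule.quotEquivOfEq _ _ ?_).length_eq
  ext c
  rw [LinearMap.mem_ker, Submodule.mem_comap, Submodule.subtype_apply, fiberMap_apply]
  refine Ideal.Quotient.eq_zero_iff_mem.trans ?_
  have := reesMonomial_mem_iff hJI (i := p) (j := 1) c.2
  rwa [pow_one, pow_one] at this

end Pieces

/-! ### The map from `C` to the associated graded ring -/

section Kernel

variable {R : Type*} [CommRing R] {I J : Ideal R}

/-- Taking coefficients identifies the piece with one copy of `fiberPiece` for each monomial of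
degree n in d + 1 variables. -/
theorem length_cPiece (d i n : ℕ) :
    Module.length R ↥(cPiece I J (d + 1) i n) =
      Module.length R ↥(fiberPiece I J i) * ((n + d).choose d : ℕ) := by
  classical
  set S := Finset.finsuppAntidiag (Finset.univ : Finset (Fin (d + 1))) n with hS
  have hmem : ∀ s : Fin (d + 1) →₀ ℕ, s ∈ S ↔ s.degree = n := fun s => by
    simp [hS, Finset.mem_finsuppAntidiag, Finsupp.degree_eq_sum]
  let e : ↥(cPiece I J (d + 1) i n) →ₗ[R] (S → ↥(fiberPiece I J i)) :=
    { toFun := fun F s => ⟨(F : CRing I J (d + 1)).coeff s, F.2.2 s⟩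
      map_add' := fun F G => funext fun s => Subtype.ext (MvPolynomial.coeff_add _ _ _)
      map_smul' := fun r F => funext fun s => Subtype.ext (MvPolynomial.coeff_smul _ _ _) }
  have he : Function.Bijective e := by
    constructor
    · intro F G hFG
      refine Subtype.ext (MvPolynomial.ext _ _ fun s => ?_)
      by_cases hs : s.degree = n
      · exact congrArg Subtype.val (congrFun hFG ⟨s, (hmem s).mpr hs⟩)
      · rw [F.2.1.coeff_eq_zero hs, G.2.1.coeff_eq_zero hs]
    · intro g
      have hcoeff : ∀ s, (∑ t : S, MvPolynomial.monomial (t : Fin (d + 1) →₀ ℕ)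
          (g t : FiberRing I J)).coeff s = if h : s ∈ S then (g ⟨s, h⟩ : FiberRing I J) else 0 := by
        intro s
        simp only [MvPolynomial.coeff_sum, MvPolynomial.coeff_monomial]
        split_ifs with h
        · refine (Fintype.sum_eq_single (⟨s, h⟩ : S) fun t ht => ?_).trans (if_pos rfl)
          exact if_neg fun h' => ht (Subtype.ext h')
        · refine Finset.sum_eq_zero fun t _ => if_neg ?_
          rintro rfl
          exact h t.2
      refine ⟨⟨∑ t : S, MvPolynomial.monomial (t : Fin (d + 1) →₀ ℕ) (g t : FiberRing I J),
        MvPolynomial.IsHomogeneous.sum _ _ _ fun t _ =>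
          MvPolynomial.isHomogeneous_monomial _ ((hmem _).mp t.2), fun s => ?_⟩, ?_⟩
      · rw [hcoeff]
        split_ifs
        · exact (g _).2
        · exact Submodule.zero_mem _
      · funext s
        refine Subtype.ext ((hcoeff s).trans ?_)
        rw [dif_pos s.2]
  rw [(LinearEquiv.ofBijective e he).length_eq, Module.length_pi, mul_comm]
  congr 1
  rw [ENat.card_eq_coe_fintype_card, Fintype.card_coe, hS,
    Finset.card_finsuppAntidiag_nat_eq_choose]
  simp only [Finset.card_univ, Fintype.card_fin]
  rw [show d + 1 + n - 1 = n + d by omega, Nat.choose_symm_add]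

variable (hJI : J ≤ I) {d : ℕ} (a : Fin d → ↥J)

theorem toGr_mk (f : ↥(reesAlgebra I)) :
    FiberRing.toGr I J (FiberRing.mk I J f) =
      AssocGr.mk (R := ↥(reesAlgebra I)) (reesIdeal I J) (algebraMap _ _ f) := rfl

theorem piHom_smul (c : R) (F : CRing I J d) : piHom hJI a (c • F) = c • piHom hJI a F := by
  have h1 : c • F = MvPolynomial.C (FiberRing.mk I J (algebraMap R _ c)) * F := by
    rw [Algebra.smul_def]
    rfl
  have h2 : c • piHom hJI a F = AssocGr.mk (R := ↥(reesAlgebra I)) (reesIdeal I J)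
      (algebraMap _ _ (algebraMap R ↥(reesAlgebra I) c)) * piHom hJI a F := by
    rw [Algebra.smul_def]
    rfl
  rw [h1, h2, map_mul, ← toGr_mk]
  congr 1
  exact MvPolynomial.eval₂Hom_C _ _ _

/-- The map `π` as an `R`-linear map. -/
def piLin : CRing I J d →ₗ[R] GrRees I J where
  toFun := piHom hJI a
  map_add' := map_add _
  map_smul' := piHom_smul hJI a

theorem piHom_monomial (s : Fin d →₀ ℕ) (f : ↥(reesAlgebra I)) :
    ∃ hf, piHom hJI a (MvPolynomial.monomial s (FiberRing.mk I J f)) =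
      AssocGr.of (reesIdeal I J) s.degree
        (f * ∏ i, reesMonomial I 1 (a i : R) (by rw [pow_one]; exact hJI (a i).2) ^ s i) hf := by
  set g : Fin d → ↥(reesAlgebra I) := fun i =>
    reesMonomial I 1 (a i : R) (by rw [pow_one]; exact hJI (a i).2) with hg
  have hgJ : ∀ i, g i ∈ reesIdeal I J := fun i => Ideal.subset_span ⟨(a i : R), (a i).2, rfl⟩
  have hf : f * ∏ i, g i ^ s i ∈ reesIdeal I J ^ s.degree := by
    refine Ideal.mul_mem_left _ _ ?_
    rw [Finsupp.degree_eq_sum, ← Finset.prod_pow_eq_pow_sum]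
    exact Ideal.prod_mem_prod fun i _ => Ideal.pow_mem_pow (hgJ i) _
  refine ⟨hf, ?_⟩
  have hpi : piHom hJI a (MvPolynomial.monomial s (FiberRing.mk I J f)) =
      FiberRing.toGr I J (FiberRing.mk I J f) * s.prod fun i k =>
        AssocGr.of (reesIdeal I J) 1 (g i) (by rw [pow_one]; exact hgJ i) ^ k :=
    MvPolynomial.eval₂_monomial _ _
  rw [hpi, toGr_mk, Finsupp.prod_fintype _ _ (fun i => pow_zero _)]
  unfold AssocGr.of
  simp only [← map_pow, ← map_prod, ← map_mul]
  congr 1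
  refine Subtype.ext ?_
  simp only [MulMemClass.coe_mul, SubmonoidClass.coe_finsetProd, SubmonoidClass.coe_pow]
  change C f * _ = _
  simp only [← C_mul_X_pow_eq_monomial, pow_one, mul_pow, Finset.prod_mul_distrib,
    ← map_pow, ← map_prod, Finset.prod_pow_eq_pow_sum, Finsupp.degree_eq_sum, ← mul_assoc,
    ← map_mul]
  rfl

theorem prod_reesMonomial (s : Fin d →₀ ℕ) :
    ((∏ i, reesMonomial I 1 (a i : R) (by rw [pow_one]; exact hJI (a i).2) ^ s i :
      ↥(reesAlgebra I)) : R[X]) = monomial s.degree (∏ i, (a i : R) ^ s i) := by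
  simp only [SubmonoidClass.coe_finsetProd, SubmonoidClass.coe_pow, reesMonomial,
    ← C_mul_X_pow_eq_monomial, pow_one, mul_pow, Finset.prod_mul_distrib,
    ← map_pow, ← map_prod, Finset.prod_pow_eq_pow_sum, Finsupp.degree_eq_sum]

theorem piHom_X_mul (k : Fin d) {i n : ℕ} {c : R} (hc : c ∈ J ^ n * I ^ i)
    (hc' : (a k : R) * c ∈ J ^ (n + 1) * I ^ i) {F : CRing I J d}
    (hF : piHom hJI a F = grMap hJI i n ⟨c, hc⟩) :
    piHom hJI a (MvPolynomial.X k * F) = grMap hJI i (n + 1) ⟨a k * c, hc'⟩ := by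
  have hX : piHom hJI a (MvPolynomial.X k) = AssocGr.of (reesIdeal I J) 1
      (reesMonomial I 1 (a k : R) (by rw [pow_one]; exact hJI (a k).2))
      (by rw [pow_one]; exact Ideal.subset_span ⟨(a k : R), (a k).2, rfl⟩) :=
    MvPolynomial.eval₂_X _ _ _
  rw [map_mul, hF, hX]
  change AssocGr.mk (R := ↥(reesAlgebra I)) (reesIdeal I J) _ *
    AssocGr.mk (R := ↥(reesAlgebra I)) (reesIdeal I J) _ =
    AssocGr.mk (R := ↥(reesAlgebra I)) (reesIdeal I J) _
  rw [← map_mul]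
  congr 1
  refine Subtype.ext ?_
  change monomial 1 _ * monomial n _ = monomial (n + 1) _
  rw [monomial_mul_monomial, add_comm 1 n]
  congr 1
  refine Subtype.ext ?_
  change monomial 1 _ * monomial (i + n) _ = monomial (i + (n + 1)) _
  rw [monomial_mul_monomial, show 1 + (i + n) = i + (n + 1) by ring]

theorem map_piLin_cPiece (ha : Ideal.span (Set.range fun i => (a i : R)) = J) (i n : ℕ) :
    (cPiece I J d i n).map (piLin hJI a) = grPiece I J i n := by
  refine le_antisymm ?_ ?_
  · rintro _ ⟨F, ⟨hF, hFi⟩, rfl⟩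
    change piHom hJI a F ∈ _
    rw [F.as_sum, map_sum]
    refine Submodule.sum_mem _ fun s hs => ?_
    have hdeg : s.degree = n := by
      by_contra h
      exact (MvPolynomial.mem_support_iff.mp hs) (hF.coeff_eq_zero h)
    obtain ⟨f, hf, hfs⟩ := hFi s
    obtain ⟨c, hc, rfl⟩ := exists_reesMonomial_of_mem_reesPiece hf
    have hfs' : FiberRing.mk I J (reesMonomial I i c hc) = F.coeff s := hfs
    obtain ⟨h, hpi⟩ := piHom_monomial hJI a s (reesMonomial I i c hc)
    rw [← hfs', hpi]
    subst hdeg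
    refine ⟨_, h, ⟨c * ∏ k, (a k : R) ^ s k, ?_⟩, rfl⟩
    change _ = ((reesMonomial I i c hc * _ : ↥(reesAlgebra I)) : R[X])
    rw [MulMemClass.coe_mul, prod_reesMonomial hJI, reesMonomial, monomial_mul_monomial]
  -- `W n` consists of the c whose class is hit by π. It is an ideal, so the induction on n only
  -- needs multiplication by the generators a_k, that is, by the variables.
  · set W : ℕ → Ideal R := fun n =>
      (((cPiece I J d i n).map (piLin hJI a)).comap (grMap hJI i n)).map
        (J ^ n * I ^ i).subtype with hW
    suffices h : ∀ n, J ^ n * I ^ i ≤ W n by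
      rw [← range_grMap hJI]
      rintro _ ⟨⟨c, hc⟩, rfl⟩
      obtain ⟨⟨c', hc'⟩, h', rfl⟩ := h n hc
      exact h'
    intro n
    induction n with
    | zero =>
      intro c hc
      have hc' : c ∈ I ^ i := by simpa using hc
      refine ⟨⟨c, hc⟩, ⟨MvPolynomial.C (FiberRing.mk I J (reesMonomial I i c hc')),
        ⟨MvPolynomial.isHomogeneous_C _ _, fun s => ?_⟩, ?_⟩, rfl⟩
      · rw [MvPolynomial.coeff_C]
        split_ifs
        · exact ⟨_, ⟨c, rfl⟩, rfl⟩
        · exact Submodule.zero_mem _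
      · refine (MvPolynomial.eval₂Hom_C _ _ _).trans ?_
        rfl
    | succ n ih =>
      have hle : J * (J ^ n * I ^ i) = J ^ (n + 1) * I ^ i := by rw [← mul_assoc, ← pow_succ']
      rw [← hle, Ideal.mul_le]
      intro b hb c hc
      rw [← ha] at hb
      induction hb using Submodule.span_induction with
      | mem b hb =>
        obtain ⟨k, rfl⟩ := hb
        obtain ⟨⟨c, hc⟩, ⟨F, hF, hFc⟩, rfl⟩ := ih hc
        have hkc : (a k : R) * c ∈ J ^ (n + 1) * I ^ i := hle ▸ Ideal.mul_mem_mul (a k).2 hc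
        refine ⟨⟨(a k : R) * c, hkc⟩, ⟨MvPolynomial.X k * F, ⟨?_, fun s => ?_⟩,
          piHom_X_mul hJI a k hc hkc hFc⟩, rfl⟩
        · rw [add_comm]
          exact (MvPolynomial.isHomogeneous_X _ k).mul hF.1
        · rw [MvPolynomial.coeff_X_mul']
          split_ifs
          · exact hF.2 _
          · exact Submodule.zero_mem _
      | zero =>
        rw [zero_mul]
        exact Ideal.zero_mem _
      | add x y _ _ hx hy =>
        rw [add_mul]
        exact Ideal.add_mem _ hx hy
      | smul r x _ hx =>
        rw [smul_eq_mul, mul_assoc]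
        exact Ideal.mul_mem_left _ _ hx

theorem kHilb_add_sigmaHilb (ha : Ideal.span (Set.range fun i => (a i : R)) = J) (p n : ℕ) :
    kHilb hJI a p n + sigmaHilb I J p n = Module.length R ↥(cPiece I J d (p + 1) n) := by
  rw [sigmaHilb, ← map_piLin_cPiece hJI a ha]
  refine (Module.length_eq_add_of_exact
    (Submodule.inclusion (inf_le_right : kerPiece hJI a (p + 1) n ≤ cPiece I J d (p + 1) n))
    ((piLin hJI a).submoduleMap (cPiece I J d (p + 1) n)) (Submodule.inclusion_injective _)
    (LinearMap.submoduleMap_surjective _ _) ?_).symm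
  intro F
  constructor
  · intro h
    exact ⟨⟨F, congrArg Subtype.val h, F.2⟩, rfl⟩
  · rintro ⟨G, rfl⟩
    exact Subtype.ext G.2.1

end Kernel

/-! ### Reductions of `m`-primary ideals -/

section Reductions

variable {R : Type*} [CommRing R] {I J : Ideal R} {r : ℕ}

theorem pow_succ_eq_mul_pow_of_le (hr : I ^ (r + 1) = J * I ^ r) {p : ℕ} (hp : r ≤ p) :
    I ^ (p + 1) = J * I ^ p := by
  obtain ⟨q, rfl⟩ := Nat.exists_eq_add_of_le hp
  rw [show r + q + 1 = r + 1 + q by ring, pow_add, hr, mul_assoc, ← pow_add]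

theorem mul_pow_le_pow_succ (hJI : J ≤ I) (p : ℕ) : J * I ^ p ≤ I ^ (p + 1) := by
  rw [pow_succ']
  exact Ideal.mul_mono_left hJI

theorem pow_succ_mul_pow_le (hJI : J ≤ I) (n p : ℕ) :
    J ^ (n + 1) * I ^ p ≤ J ^ n * I ^ (p + 1) := by
  rw [pow_succ, mul_assoc]
  exact Ideal.mul_mono_right (mul_pow_le_pow_succ hJI p)

theorem pow_le_pow_mul_pow (hr : I ^ (r + 1) = J * I ^ r) (n q : ℕ) :
    I ^ ((r + 1) * n + q) ≤ J ^ n * I ^ q := by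
  rw [pow_add, pow_mul]
  exact Ideal.mul_mono_left (Ideal.pow_right_mono (hr ▸ Ideal.mul_le_left) n)

/-- The pieces with j ≥ m are zero, so the sum is independent of n once n ≥ m. Reindexing by j = m -
1 - p leaves the diagonals p < r, all of which occur when m ≥ r. -/
theorem kBigradedHilb_eq (hJI : J ≤ I) {d : ℕ} (a : Fin d → ↥J)
    (hzero : ∀ p ≥ r, ∀ n, kHilb hJI a p n = 0) {m n : ℕ} (hm : r ≤ m) (hn : m ≤ n) :
    kBigradedHilb hJI a m n = ∑ p ∈ Finset.range r, kHilb hJI a p (m - 1 - p) := by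
  have h1 : kBigradedHilb hJI a m n = ∑ j ∈ Finset.range m, kHilb hJI a (m - 1 - j) j := by
    rw [kBigradedHilb, ← Finset.sum_subset (Finset.range_mono (show m ≤ n + 1 by omega))]
    · refine Finset.sum_congr rfl fun j hj => ?_
      have hj := Finset.mem_range.mp hj
      rw [kPiece, if_pos hj, kHilb, show m - 1 - j + 1 = m - j by omega]
    · intro j _ hj
      rw [kPiece, if_neg (by simpa using hj), Module.length_bot]
  rw [h1, ← Finset.sum_range_reflect, Finset.sum_subset (Finset.range_mono hm)]
  · refine Finset.sum_congr rfl fun j hj => ?_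
    have hj := Finset.mem_range.mp hj
    rw [show m - 1 - (m - 1 - j) = j by omega]
  · intro p _ hp
    exact hzero p (by simpa using hp) _

variable [IsLocalRing R] [IsNoetherianRing R]

theorem length_quotient_pow_mul_pow_ne_top (hI : I.radical = IsLocalRing.maximalIdeal R)
    (hr : I ^ (r + 1) = J * I ^ r) (n q : ℕ) : Module.length R (R ⧸ (J ^ n * I ^ q)) ≠ ⊤ :=
  length_quotient_ne_top hI (pow_le_pow_mul_pow hr n q)

theorem length_quotient_mul_pow_ne_top (hI : I.radical = IsLocalRing.maximalIdeal R)
    (hr : I ^ (r + 1) = J * I ^ r) (p : ℕ) : Module.length R (R ⧸ (J * I ^ p)) ≠ ⊤ := by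
  have := length_quotient_pow_mul_pow_ne_top hI hr 1 p
  rwa [pow_one] at this

theorem sigmaHilb_ne_top (hI : I.radical = IsLocalRing.maximalIdeal R)
    (hr : I ^ (r + 1) = J * I ^ r) (hJI : J ≤ I) (p n : ℕ) : sigmaHilb I J p n ≠ ⊤ := by
  rw [sigmaHilb_eq hJI]
  exact quotLength_ne_top (pow_succ_mul_pow_le hJI n p)
    (length_quotient_pow_mul_pow_ne_top hI hr _ _)

theorem sigmaHilb_toNat (hI : I.radical = IsLocalRing.maximalIdeal R)
    (hr : I ^ (r + 1) = J * I ^ r) (hJI : J ≤ I) (p n : ℕ) :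
    ((sigmaHilb I J p n).toNat : ℤ) =
      colength (J ^ (n + 1) * I ^ p) - colength (J ^ n * I ^ (p + 1)) := by
  rw [sigmaHilb_eq hJI]
  exact quotLength_toNat (pow_succ_mul_pow_le hJI n p)
    (length_quotient_pow_mul_pow_ne_top hI hr _ _)

theorem isHP_sigmaHilb (hI : I.radical = IsLocalRing.maximalIdeal R)
    (hr : I ^ (r + 1) = J * I ^ r) (hJI : J ≤ I) {d : ℕ} {a : Fin d → ↥J}
    (ha : Ideal.span (Set.range fun i => (a i : R)) = J) (p : ℕ) :
    IsHP d fun n => ((sigmaHilb I J p n).toNat : ℤ) := by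
  simp only [sigmaHilb_eq hJI]
  refine isHP_quotLength _ ha (fun n => J ^ n * I ^ (p + 1)) (fun n => J ^ (n + 1) * I ^ p)
    (fun n => Ideal.mul_le_left) (fun n => ?_) (fun n => ?_) fun n => ?_
  · rw [← mul_assoc, ← pow_succ']
  · rw [← mul_assoc, ← pow_succ']
  · rw [← sigmaHilb_eq hJI]
    exact sigmaHilb_ne_top hI hr hJI p n

theorem sum_sigmaHilb (hI : I.radical = IsLocalRing.maximalIdeal R)
    (hr : I ^ (r + 1) = J * I ^ r) (hJI : J ≤ I) {n : ℕ} (hn : r ≤ n) :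
    ∑ p ∈ Finset.range r, ((sigmaHilb I J p (n - p)).toNat : ℤ) =
      colength (J ^ (n + 1)) - colength (I ^ (n + 1)) := by
  have h1 : ∀ p ∈ Finset.range (n + 1), ((sigmaHilb I J p (n - p)).toNat : ℤ) =
      colength (J ^ (n + 1 - p) * I ^ p) - colength (J ^ (n + 1 - (p + 1)) * I ^ (p + 1)) := by
    intro p hp
    have := Finset.mem_range.mp hp
    rw [sigmaHilb_toNat hI hr hJI, show n - p + 1 = n + 1 - p by omega,
      show n - p = n + 1 - (p + 1) by omega]
  -- The terms with p ≥ r vanish because I^(p+1) = J I^p. Adding them completes the chain from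
  -- J^(n+1) to I^(n+1), along which colengths telescope.
  have h2 : ∑ p ∈ Finset.range r, ((sigmaHilb I J p (n - p)).toNat : ℤ) =
      ∑ p ∈ Finset.range (n + 1), ((sigmaHilb I J p (n - p)).toNat : ℤ) := by
    refine Finset.sum_subset (Finset.range_mono (by omega)) fun p _ hp => ?_
    rw [sigmaHilb_eq hJI, pow_succ_eq_mul_pow_of_le hr (by simpa using hp), ← mul_assoc,
      ← pow_succ, quotLength_self]
    rfl
  rw [h2, Finset.sum_congr rfl h1,
    Finset.sum_range_sub' (fun p => colength (J ^ (n + 1 - p) * I ^ p))]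
  simp

theorem hilbertFn_one (hI : I.radical = IsLocalRing.maximalIdeal R) (n : ℕ) :
    ∃ k : ℕ, hilbertFn I 1 n = k ∧ (k : ℤ) = colength (I ^ (n + 1)) := by
  have h : hilbertFn I 1 n = Module.length R (R ⧸ I ^ (n + 1)) := by
    simp only [hilbertFn]
    induction n with
    | zero =>
      have := quotLength_add_length (Ideal.pow_le_pow_right (I := I) (Nat.zero_le 1))
      have h0 : Module.length R (R ⧸ I ^ 0) = 0 := by
        rw [Module.length_eq_zero_iff, pow_zero]
        exact Ideal.Quotient.subsingleton_iff.mpr Ideal.one_eq_top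
      rw [h0, add_zero] at this
      simpa using this
    | succ n ih =>
      rw [Finset.sum_range_succ, ih, add_comm]
      exact quotLength_add_length (Ideal.pow_le_pow_right n.succ.le_succ)
  have hfin := length_quotient_ne_top hI (le_refl (I ^ (n + 1)))
  exact ⟨_, h.trans (ENat.natCast_toNat hfin).symm, rfl⟩

/-! ### Reductions generated by a system of parameters -/

open RingTheory.Sequence IsLocalRing

/-- A prime containing J contains I^(r+1), hence I and its radical, so the d generators form a
system of parameters. -/
theorem isWeaklyRegular_of_reduction (hCM : IsCohenMacaulayLocal R) {d : ℕ}
    (hdim : ringKrullDim R = ((d : ℕ) : WithBot ℕ∞)) (hI : I.radical = maximalIdeal R)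
    (hr : I ^ (r + 1) = J * I ^ r) (hJI : J ≤ I) {rs : List R} (hrs : rs.length = d)
    (hrsJ : Ideal.ofList rs = J) : IsWeaklyRegular R rs := by
  obtain ⟨ss, hss, hreg, hlen⟩ := hCM
  refine isWeaklyRegular_of_parameters rs (fun x hx => ?_) ⟨ss, ?_, hss, hreg⟩ fun P hP _ hrP => ?_
  · rw [← hI]
    exact Ideal.le_radical (hJI (hrsJ ▸ Ideal.subset_span hx))
  · rw [hrs]
    exact_mod_cast hlen.trans hdim
  · refine le_antisymm (IsLocalRing.le_maximalIdeal hP.ne_top) ?_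
    rw [← hI, hP.radical_le_iff]
    have hJP : J ≤ P := by
      rw [← hrsJ]
      exact Ideal.span_le.mpr hrP
    exact hP.le_of_pow_le (n := r + 1) ((hr ▸ Ideal.mul_le_left : I ^ (r + 1) ≤ J).trans hJP)

theorem colength_pow_of_reduction {rs : List R} (hrs : ∀ x ∈ rs, x ∈ maximalIdeal R)
    (hreg : IsWeaklyRegular R rs) (n : ℕ) :
    colength (Ideal.ofList rs ^ (n + 1)) =
      colength (Ideal.ofList rs) * ((n + rs.length).choose rs.length : ℤ) := by
  have h := length_quotient_pow_sup hrs (B := ⊥)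
    (((Submodule.quotEquivOfEqBot (⊥ : Ideal R) rfl).isWeaklyRegular_congr rs).mpr hreg) n
  rw [sup_bot_eq, sup_bot_eq] at h
  rw [colength, h, ENat.toNat_mul, ENat.toNat_natCast, colength]
  push_cast
  rfl

/-- Compares J^(n+1) Q / J^(n+2), a quotient of the piece of Σ_[p], with J^(n+1) / J^(n+2) for Q =
I^(p+1) + J. Degree n + 1 is used so that the formula for colengths of positive powers applies to
both powers of J. -/
theorem LambdaLoc_sub_DeltaLoc_le (hI : I.radical = maximalIdeal R)
    (hr : I ^ (r + 1) = J * I ^ r) (hJI : J ≤ I) {d : ℕ} {rs : List R} (hlen : rs.length = d + 1)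
    (hJ : Ideal.ofList rs = J) (hreg : IsWeaklyRegular R rs) (p n : ℕ) :
    (LambdaLoc I J p - DeltaLoc I J p) * ((n + 1 + d).choose d : ℤ) ≤
      ((sigmaHilb I J p (n + 1)).toNat : ℤ) := by
  have hfin : ∀ k {N : Ideal R}, I ^ k ≤ N → Module.length R (R ⧸ N) ≠ ⊤ := fun k N h =>
    length_quotient_ne_top hI h
  have hfin' := length_quotient_pow_mul_pow_ne_top (J := J) hI hr
  have hfinJ : Module.length R (R ⧸ J) ≠ ⊤ := by
    have := hfin' 1 0
    rwa [pow_one, pow_zero, mul_one] at this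
  have hle : J * I ^ p ≤ I ^ (p + 1) ⊓ J := le_inf (mul_pow_le_pow_succ hJI p) Ideal.mul_le_left
  have hJIp : Module.length R (R ⧸ (J * I ^ p)) ≠ ⊤ := length_quotient_mul_pow_ne_top hI hr p
  set Q := I ^ (p + 1) ⊔ J with hQ
  have hfinQ : Module.length R (R ⧸ Q) ≠ ⊤ := hfin (p + 1) le_sup_left
  have hmem : ∀ x ∈ rs, x ∈ maximalIdeal R := fun x hx => by
    rw [← hI]
    exact Ideal.le_radical (hJI (hJ ▸ Ideal.subset_span hx))
  -- The difference is the length of I^(p+1) / (I^(p+1) ∩ J), which is isomorphic to Q/J.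
  have h1 : LambdaLoc I J p - DeltaLoc I J p = colength J - colength Q := by
    have hinf : I ^ ((r + 1) * 1 + p) ≤ I ^ (p + 1) ⊓ J :=
      (pow_le_pow_mul_pow hr 1 p).trans (by rwa [pow_one])
    rw [LambdaLoc, DeltaLoc, quotLength_toNat (mul_pow_le_pow_succ hJI p) hJIp,
      quotLength_toNat hle hJIp, ← quotLength_toNat le_sup_right hfinJ, ← quotLength_inf_eq,
      quotLength_toNat inf_le_left (hfin _ hinf)]
    ring
  have hnext : J ^ (n + 1 + 1) ≤ J ^ (n + 1) * Q := by
    rw [pow_succ]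
    exact Ideal.mul_mono_right le_sup_right
  have hfinn : Module.length R (R ⧸ J ^ (n + 1 + 1)) ≠ ⊤ := by
    have := hfin' (n + 1 + 1) 0
    rwa [pow_zero, mul_one] at this
  have hfinq : Module.length R (R ⧸ (J ^ (n + 1) * Q)) ≠ ⊤ :=
    ne_top_of_le_ne_top hfinn (Module.length_le_of_surjective (Submodule.factor hnext)
      (Submodule.factor_surjective _))
  have h2 : colength (J ^ (n + 1 + 1)) - colength (J ^ (n + 1) * Q) ≤
      ((sigmaHilb I J p (n + 1)).toNat : ℤ) := by
    rw [← quotLength_toNat hnext hfinn]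
    refine Int.ofNat_le.mpr (ENat.toNat_le_toNat ?_ (sigmaHilb_ne_top hI hr hJI _ _))
    rw [sigmaHilb_eq hJI]
    have := quotLength_sup_le (J ^ (n + 1) * I ^ (p + 1)) (J ^ (n + 1 + 1) * I ^ p)
      (J ^ (n + 1 + 1)) (J ^ (n + 1 + 1))
    rw [quotLength_self, add_zero, sup_eq_right.mpr
      (Ideal.mul_le_left : J ^ (n + 1 + 1) * I ^ p ≤ J ^ (n + 1 + 1)), pow_succ J (n + 1),
      ← Ideal.mul_sup] at this
    rwa [← pow_succ] at this
  have h3 : colength (J ^ (n + 1) * Q) - colength (J ^ (n + 1)) ≤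
      colength Q * ((n + 1 + d).choose d : ℤ) := by
    rw [← quotLength_toNat Ideal.mul_le_left hfinq]
    have := quotLength_pow_le rs Q (n + 1)
    rw [hJ, hlen, Nat.multichoose_eq, show d + 1 + (n + 1) - 1 = n + 1 + d by omega,
      Nat.choose_symm_add] at this
    have h := ENat.toNat_le_toNat this (WithTop.mul_ne_top hfinQ (ENat.natCast_ne_top _))
    rw [ENat.toNat_mul, ENat.toNat_natCast] at h
    rw [colength]
    exact_mod_cast h
  have h4 := colength_pow_of_reduction hmem hreg (n + 1)
  have h5 := colength_pow_of_reduction hmem hreg n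
  rw [hJ, hlen] at h4 h5
  rw [choose_succ_add_succ] at h4
  rw [h1]
  linarith

theorem kHilb_add_sigmaHilb_toNat (hI : I.radical = maximalIdeal R)
    (hr : I ^ (r + 1) = J * I ^ r) (hJI : J ≤ I) {d : ℕ} (a : Fin (d + 1) → ↥J)
    (ha : Ideal.span (Set.range fun i => (a i : R)) = J) (p n : ℕ) :
    kHilb hJI a p n ≠ ⊤ ∧ ((kHilb hJI a p n).toNat : ℤ) =
      LambdaLoc I J p * ((n + d).choose d : ℤ) - ((sigmaHilb I J p n).toNat : ℤ) := by
  have h := kHilb_add_sigmaHilb hJI a ha p n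
  rw [length_cPiece, length_fiberPiece hJI] at h
  have hfin : quotLength (I ^ (p + 1)) (J * I ^ p) ≠ ⊤ :=
    quotLength_ne_top (mul_pow_le_pow_succ hJI p)
      (length_quotient_mul_pow_ne_top hI hr p)
  have hne : kHilb hJI a p n + sigmaHilb I J p n ≠ ⊤ := by
    rw [h]
    exact WithTop.mul_ne_top hfin (ENat.natCast_ne_top _)
  rw [Ne, ENat.add_eq_top, not_or] at hne
  refine ⟨hne.1, ?_⟩
  have h' := congrArg ENat.toNat h
  rw [ENat.toNat_add hne.1 hne.2, ENat.toNat_mul, ENat.toNat_natCast] at h'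
  rw [LambdaLoc, eq_sub_iff_add_eq]
  exact_mod_cast h'

end Reductions

end BigradedSally

end

/-! ### Proof of the main theorem -/

theorem mainTheorem3 {R : Type*} [CommRing R] [IsLocalRing R] [IsNoetherianRing R]
    (hCM : BigradedSally.IsCohenMacaulayLocal R)
    (d : ℕ) (hd : 0 < d) (hdim : ringKrullDim R = ((d : ℕ) : WithBot ℕ∞))
    (I J : Ideal R) (hI : I.radical = IsLocalRing.maximalIdeal R)
    (hJ : BigradedSally.IsMinimalReduction J I)
    (a : Fin d → ↥J) (ha : Ideal.span (Set.range fun i => (a i : R)) = J) :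
    -- all the quantities involved are well defined
    ((∀ p : ℕ, BigradedSally.quotLength (I ^ (p + 1)) (J * I ^ p) ≠ ⊤) ∧
      (∀ p : ℕ, BigradedSally.quotLength (I ^ (p + 1) ⊓ J) (J * I ^ p) ≠ ⊤) ∧
      (∀ p : ℕ, ∃ e : ℕ → ℤ,
        BigradedSally.IsHilbertCoeffs d (BigradedSally.sigmaHilb I J p) e) ∧
      (∀ p : ℕ, ∃ e : ℕ → ℤ,
        BigradedSally.IsHilbertCoeffs d (BigradedSally.kHilb hJ.1.1 a p) e) ∧
      (∃ e : ℕ → ℤ,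
        BigradedSally.IsBigradedHilbertCoeffs d (BigradedSally.kBigradedHilb hJ.1.1 a) e) ∧
      (∃ e : ℕ → ℤ,
        BigradedSally.IsHilbertCoeffs (d + 1) (BigradedSally.hilbertFn I 1) e) ∧
      (BigradedSally.LambdaLoc I J).support.Finite ∧
      (BigradedSally.DeltaLoc I J).support.Finite ∧
      (BigradedSally.deltaLoc hJ.1.1 a).support.Finite ∧
      (BigradedSally.e0Sigma d I J).support.Finite) ∧
    -- the local inequalities
    (∀ p : ℕ,
      BigradedSally.deltaLoc hJ.1.1 a p ≤ BigradedSally.DeltaLoc I J p ∧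
      BigradedSally.deltaLoc hJ.1.1 a p =
        BigradedSally.LambdaLoc I J p - BigradedSally.e0Sigma d I J p ∧
      0 ≤ BigradedSally.deltaLoc hJ.1.1 a p ∧
      0 ≤ BigradedSally.e0Sigma d I J p) ∧
    -- summing up
    BigradedSally.deltaTot d I J = ∑ᶠ p : ℕ, BigradedSally.deltaLoc hJ.1.1 a p ∧
    BigradedSally.deltaTot d I J = BigradedSally.e0K hJ.1.1 a ∧
    BigradedSally.deltaTot d I J ≤ BigradedSally.DeltaTot I J ∧
    BigradedSally.deltaTot d I J =
      BigradedSally.LambdaTot I J - BigradedSally.idealHilbertCoeff d I 1 ∧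
    0 ≤ BigradedSally.deltaTot d I J ∧
    BigradedSally.idealHilbertCoeff d I 1 = ∑ᶠ p : ℕ, BigradedSally.e0Sigma d I J p ∧
    BigradedSally.idealHilbertCoeff d I 1 =
      ∑ᶠ p : ℕ, (BigradedSally.LambdaLoc I J p - BigradedSally.deltaLoc hJ.1.1 a p) := by
  obtain ⟨d, rfl⟩ : ∃ k, d = k + 1 := Nat.exists_eq_succ_of_ne_zero hd.ne'
  obtain ⟨⟨hJI, r, hr⟩, -⟩ := id hJ
  set rs : List R := List.ofFn fun i => (a i : R) with hrs
  have hrsJ : Ideal.ofList rs = J := by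
    rw [← ha, Ideal.ofList]
    congr 1
    ext x
    exact List.mem_ofFn
  have hlen : rs.length = d + 1 := by simp [hrs]
  have hmem : ∀ x ∈ rs, x ∈ IsLocalRing.maximalIdeal R := fun x hx => by
    rw [← hI]
    exact Ideal.le_radical (hJI (hrsJ ▸ Ideal.subset_span hx))
  have hreg := BigradedSally.isWeaklyRegular_of_reduction hCM hdim hI hr hJI hlen hrsJ
  have hJIp := BigradedSally.length_quotient_mul_pow_ne_top (J := J) hI hr
  -- the functions of `Σ` and `K`
  have hsig : ∀ p, ∀ᶠ n in atTop, ∃ k : ℕ, BigradedSally.sigmaHilb I J p n = k ∧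
      (k : ℤ) = ((BigradedSally.sigmaHilb I J p n).toNat : ℤ) := fun p =>
    Eventually.of_forall fun n =>
      ⟨_, (ENat.natCast_toNat (BigradedSally.sigmaHilb_ne_top hI hr hJI p n)).symm, rfl⟩
  have hker : ∀ p n, ∃ k : ℕ, BigradedSally.kHilb hJ.1.1 a p n = k ∧
      (k : ℤ) = BigradedSally.LambdaLoc I J p * ((n + d).choose d : ℤ) -
        ((BigradedSally.sigmaHilb I J p n).toNat : ℤ) := fun p n => by
    obtain ⟨h1, h2⟩ := BigradedSally.kHilb_add_sigmaHilb_toNat hI hr hJ.1.1 a ha p n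
    exact ⟨_, (ENat.natCast_toNat h1).symm, h2⟩
  have hsigP := BigradedSally.isHP_sigmaHilb hI hr hJI ha
  have hsigL : ∀ p, BigradedSally.IsHPLead d (BigradedSally.e0Sigma (d + 1) I J p)
      fun n => ((BigradedSally.sigmaHilb I J p n).toNat : ℤ) := fun p => by
    obtain ⟨c, hc⟩ := (hsigP p).exists_lead
    rwa [BigradedSally.e0Sigma, BigradedSally.hilbertCoeff_zero_eq (hsig p) hc]
  have hkerL : ∀ p, BigradedSally.IsHPLead d
      (BigradedSally.LambdaLoc I J p - BigradedSally.e0Sigma (d + 1) I J p)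
      fun n => BigradedSally.LambdaLoc I J p * ((n + d).choose d : ℤ) -
        ((BigradedSally.sigmaHilb I J p n).toNat : ℤ) := fun p => by
    simpa using ((BigradedSally.IsHPLead.choose d).const_mul
      (BigradedSally.LambdaLoc I J p)).sub (hsigL p)
  have hdel : ∀ p, BigradedSally.deltaLoc hJ.1.1 a p =
      BigradedSally.LambdaLoc I J p - BigradedSally.e0Sigma (d + 1) I J p := fun p =>
    BigradedSally.hilbertCoeff_zero_eq (Eventually.of_forall (hker p)) (hkerL p)
  have hdel0 : ∀ p, 0 ≤ BigradedSally.deltaLoc hJ.1.1 a p := fun p => by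
    rw [hdel]
    refine (hkerL p).nonneg (Eventually.of_forall fun n => ?_)
    obtain ⟨k, -, hk⟩ := hker p n
    rw [← hk]
    exact Int.natCast_nonneg k
  have hsig0 : ∀ p, 0 ≤ BigradedSally.e0Sigma (d + 1) I J p := fun p =>
    (hsigL p).nonneg (Eventually.of_forall fun n => Int.natCast_nonneg _)
  have hle : ∀ p, BigradedSally.deltaLoc hJ.1.1 a p ≤ BigradedSally.DeltaLoc I J p := fun p => by
    have h := ((BigradedSally.IsHPLead.choose d).const_mul
      (BigradedSally.LambdaLoc I J p - BigradedSally.DeltaLoc I J p)).le (hsigL p) (by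
        filter_upwards [eventually_ge_atTop 1] with n hn
        obtain ⟨n, rfl⟩ := Nat.exists_eq_add_of_le' hn
        exact BigradedSally.LambdaLoc_sub_DeltaLoc_le hI hr hJI hlen hrsJ hreg p n)
    rw [hdel]
    linarith
  -- vanishing for large `p`
  have hLam0 : ∀ p ≥ r, BigradedSally.LambdaLoc I J p = 0 := fun p hp => by
    rw [BigradedSally.LambdaLoc, BigradedSally.pow_succ_eq_mul_pow_of_le hr hp,
      BigradedSally.quotLength_self]
    rfl
  have hDel0 : ∀ p ≥ r, BigradedSally.DeltaLoc I J p = 0 := fun p hp => by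
    rw [BigradedSally.DeltaLoc, BigradedSally.pow_succ_eq_mul_pow_of_le hr hp,
      inf_eq_left.mpr Ideal.mul_le_left, BigradedSally.quotLength_self]
    rfl
  -- Here δ_p is squeezed between 0 and Δ_p = 0.
  have hdelr : ∀ p ≥ r, BigradedSally.deltaLoc hJ.1.1 a p = 0 := fun p hp =>
    le_antisymm (hDel0 p hp ▸ hle p) (hdel0 p)
  have hsigr : ∀ p ≥ r, BigradedSally.e0Sigma (d + 1) I J p = 0 := fun p hp => by
    have h1 := hdel p
    rw [hdelr p hp, hLam0 p hp] at h1
    linarith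
  have hkr : ∀ p ≥ r, ∀ n, BigradedSally.kHilb hJ.1.1 a p n = 0 := fun p hp n => by
    obtain ⟨k, hk, hk'⟩ := hker p n
    rw [hLam0 p hp, zero_mul] at hk'
    have : k = 0 := by omega
    rw [hk, this]
    rfl
  have hsupp : ∀ f : ℕ → ℤ, (∀ p ≥ r, f p = 0) →
      f.support ⊆ ↑(Finset.range r) := fun f hf p hp => by
    simp only [Finset.coe_range, Set.mem_Iio]
    by_contra h
    exact hp (hf p (not_lt.mp h))
  have hfinsupp : ∀ f : ℕ → ℤ, (∀ p ≥ r, f p = 0) → f.support.Finite := fun f hf =>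
    (Finset.range r).finite_toSet.subset (hsupp f hf)
  have hsum : ∀ f : ℕ → ℤ, (∀ p ≥ r, f p = 0) → ∑ᶠ p, f p = ∑ p ∈ Finset.range r, f p :=
    fun f hf => finsum_eq_sum_of_support_subset f (hsupp f hf)
  -- the first Hilbert coefficient of `I`
  have he1 := BigradedSally.hilbertCoeff_one_eq (d := d) (h := BigradedSally.hilbertFn I 1)
    (f := fun n => BigradedSally.colength (I ^ (n + 1)))
    (g := fun n => ∑ p ∈ Finset.range r, ((BigradedSally.sigmaHilb I J p (n - p)).toNat : ℤ))
    (b := BigradedSally.colength J)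
    (c := ∑ p ∈ Finset.range r, BigradedSally.e0Sigma (d + 1) I J p)
    (Eventually.of_forall (BigradedSally.hilbertFn_one hI))
    (by
      filter_upwards [eventually_ge_atTop r] with n hn
      have h := BigradedSally.colength_pow_of_reduction hmem hreg n
      rw [hrsJ, hlen] at h
      rw [BigradedSally.sum_sigmaHilb hI hr hJI hn, h]
      ring)
    -- Evaluating at n - p instead of n does not change the leading coefficient.
    (BigradedSally.IsHPLead.sum _ fun p _ => (hsigL p).shift_sub p)
  have he1' : BigradedSally.idealHilbertCoeff (d + 1) I 1 =
      ∑ p ∈ Finset.range r, BigradedSally.e0Sigma (d + 1) I J p := he1.2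
  -- the bigraded Hilbert function of `K`
  have heK := BigradedSally.bigradedHilbertCoeff_zero_eq (d := d) (N := r)
    (h := BigradedSally.kBigradedHilb hJ.1.1 a)
    (f := fun m => ∑ p ∈ Finset.range r,
      (BigradedSally.LambdaLoc I J p * ((m - 1 - p + d).choose d : ℤ) -
        ((BigradedSally.sigmaHilb I J p (m - 1 - p)).toNat : ℤ)))
    (c := ∑ p ∈ Finset.range r,
      (BigradedSally.LambdaLoc I J p - BigradedSally.e0Sigma (d + 1) I J p))
    (fun m hm n hn => by
      rw [BigradedSally.kBigradedHilb_eq hJ.1.1 a hkr hm hn]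
      choose k hk hk' using hker
      refine ⟨∑ p ∈ Finset.range r, k p (m - 1 - p), ?_, ?_⟩
      · rw [Nat.cast_sum]
        exact Finset.sum_congr rfl fun p _ => hk p _
      · rw [Nat.cast_sum]
        exact Finset.sum_congr rfl fun p _ => hk' p _)
    (BigradedSally.IsHPLead.sum _ fun p _ =>
      (((hkerL p).shift_sub p).shift_sub_one).congr (Eventually.of_forall fun n => rfl))
  have heK' : BigradedSally.e0K hJ.1.1 a = ∑ p ∈ Finset.range r,
      (BigradedSally.LambdaLoc I J p - BigradedSally.e0Sigma (d + 1) I J p) := heK.2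
  have hdelta : BigradedSally.deltaTot (d + 1) I J = ∑ p ∈ Finset.range r,
      (BigradedSally.LambdaLoc I J p - BigradedSally.e0Sigma (d + 1) I J p) := by
    rw [BigradedSally.deltaTot, BigradedSally.LambdaTot, hsum _ hLam0, he1',
      Finset.sum_sub_distrib]
  have hDeltaTot : BigradedSally.DeltaTot I J =
      ∑ p ∈ Finset.range r, BigradedSally.DeltaLoc I J p := by
    rw [← hsum _ hDel0, BigradedSally.DeltaTot]
    refine finsum_congr fun p => ?_
    -- The sum defining Δ starts at p = 1, but Δ_0 = λ((I ∩ J)/J) = 0, so including p = 0 is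
    -- harmless.
    rcases Nat.eq_zero_or_pos p with rfl | hp
    · rw [BigradedSally.DeltaLoc, zero_add, pow_one, pow_zero, mul_one, inf_eq_right.mpr hJI,
        BigradedSally.quotLength_self]
      simp
    · exact finsum_eq_if.trans (if_pos hp)
  have hsumdel : ∑ᶠ p, BigradedSally.deltaLoc hJ.1.1 a p = ∑ p ∈ Finset.range r,
      (BigradedSally.LambdaLoc I J p - BigradedSally.e0Sigma (d + 1) I J p) := by
    rw [hsum _ hdelr]
    exact Finset.sum_congr rfl fun p _ => hdel p
  refine ⟨⟨fun p => ?_, fun p => ?_, fun p => ?_, fun p => ?_, heK.1, he1.1, hfinsupp _ hLam0,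
    hfinsupp _ hDel0, hfinsupp _ hdelr, hfinsupp _ hsigr⟩,
    fun p => ⟨hle p, hdel p, hdel0 p, hsig0 p⟩, hdelta.trans hsumdel.symm, hdelta.trans heK'.symm,
    ?_, rfl, ?_, ?_, ?_⟩
  · exact BigradedSally.quotLength_ne_top (BigradedSally.mul_pow_le_pow_succ hJI p) (hJIp p)
  · exact BigradedSally.quotLength_ne_top
      (le_inf (BigradedSally.mul_pow_le_pow_succ hJI p) Ideal.mul_le_left) (hJIp p)
  · exact BigradedSally.exists_isHilbertCoeffs (hsig p) (hsigP p)
  · exact BigradedSally.exists_isHilbertCoeffs (Eventually.of_forall (hker p)) (hkerL p).isHP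
  · rw [hdelta, hDeltaTot]
    exact Finset.sum_le_sum fun p _ => hdel p ▸ hle p
  · rw [hdelta]
    exact Finset.sum_nonneg fun p _ => hdel p ▸ hdel0 p
  · rw [he1', hsum _ hsigr]
  · rw [he1', ← hsum _ hsigr]
    exact finsum_congr fun p => by rw [hdel]; ring
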